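/- **Setting.** For finite groups $G,H$ a $(G,H)$-biset is a finite set with commuting left $G$- and right $H$-actions, viewed as a left $G\times H$-set via $(g,h)u=guh^{-1}$; $B(G,H)$ is the Grothendieck group of finite $(G,H)$-bisets with respect to disjoint union. For $D\le G\times H$, $E\le H\times K$, $L\le H$ put $D*E=\{(g,k)\mid \exists h\in H:(g,h)\in D,(h,k)\in E\}$, $D*L=\{g\in G\mid\exists h\in L:(g,h)\in D\}$, $p_1(D)=D*H$, and $\Delta(G)=\{(g,g)\mid g\in G\}$. Let $\mathcal G$ be a class of finite groups and, for $G,H\in\mathcal G$, let $\mathcal S(G,H)$ be a set of subgroups of $G\times H$ such that, for all $G,H,K\in\mathcal G$: (i) $\Delta(G)\in\mathcal S(G,G)$; (ii) $\mathcal S(G,H)$ is closed under $G\times H$-conjugation; (iii) $D*E\in\mathcal S(G,K)$ for all $D\in\mathcal S(G,H)$, $E\in\mathcal S(H,K)$; (iv) for all $D\in\mathcal S(G,H)$ and all subgroups $K\le H$ with $K\in\mathcal G$, one has $D*K\in\mathcal G$ and $D*\Delta(K)=D\cap(G\times K)\in\mathcal S(D*K,K)$. Let $\Sigma_{\mathcal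 G}(G)$ be the set of subgroups of $G$ that belong to $\mathcal G$. Let $\mathcal D$ be the category with object class $\mathcal G$ in which $\mathrm{Hom}(H,G)$ is the subgroup of $B(G,H)$ generated by the classes $[(G\times H)/D]$, $D\in\mathcal S(G,H)$, with composition induced by $(U,V)\mapsto U\times_HV$ and identities $[G]$. Let $\mathcal S_+(G,H)=\{D\le G\times H\mid p_1(D)\in\mathcal G,\ D\in\mathcal S(p_1(D),H)\}$; this again satisfies (i)–(iii), and $\mathcal D_+$ denotes the category defined in the same way from $(\mathcal G,\mathcal S_+)$. Let $R$ be a commutative ring; $\mathcal F_{\mathcal D,R}$ is the category of additive functors $\mathcal D\to R\text{-Mod}$ (biset functors on $\mathcal D$ over $R$) and natural transformations, and similarly for $\mathcal D_+$. Let $F\in\mathcal F_{\mathcal D,R}$ and $G\in\mathcal G$. For $A\in\Sigma_{\mathcal G}(G)$, $g\in G$, $a\in F(A)$, let ${}^ga\in F({}^gA)$ be the image of $a$ under $F$ of the class of $({}^gA\times A)/\{(gbg^{-1},b)\mid b\in A\}$. Let $\Gamma_F(G)$ be the category of pairs $(X,s)$ where $X$ is a finite $G$-set with all stabilizers $G_x\in\mathcal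 G$ and $s$ is a $G$-equivariant section, i.e. $s(x)\in F(G_x)$ and $s(x)={}^g(s(g^{-1}x))$ for all $x\in X$, $g\in G$; a morphism $(X,s)\to(Y,t)$ is a $G$-map $\alpha$ with $G_{\alpha(x)}=G_x$ and $t(\alpha(x))=s(x)$ for all $x$. Let $F_+(G)$ be the free abelian group on the isomorphism classes $\{X,s\}$ of $\Gamma_F(G)$ modulo the subgroup generated by all $\{X\sqcup Y,s\sqcup t\}-\{X,s\}-\{Y,t\}$ and $\{X,s+u\}-\{X,s\}-\{X,u\}$; the class of $\{X,s\}$ is denoted $[X,s]$, and $r[X,s]=[X,rs]$ makes $F_+(G)$ an $R$-module. **Theorem.** (a) Let $F\in\mathcal F_{\mathcal D,R}$. For every $(G,H)$-biset $U$ with all point stabilizers in $\mathcal S_+(G,H)$ there is a functor $\Gamma_F(U)\colon\Gamma_F(H)\to\Gamma_F(G)$, given on objects by $(X,s)\mapsto(U\times_HX,U(s))$ with $$U(s)([u,x])=F\Bigl(\Bigl[\tfrac{G_{[u,x]}\times H_x}{(G\times H_x)_u}\Bigr]\Bigr)(s(x)),$$ and on morphisms by $\alpha\mapsto U\times_H\alpha$.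 The modules $F_+(G)$, $G\in\mathcal G$, together with the maps $F_+([U])\colon F_+(H)\to F_+(G)$, $[X,s]\mapsto[U\times_HX,U(s)]$, form a biset functor $F_+\in\mathcal F_{\mathcal D_+,R}$. (b) The assignment $F\mapsto F_+$ defines an $R$-linear functor $\mathcal F_{\mathcal D,R}\to\mathcal F_{\mathcal D_+,R}$; a morphism $\varphi\colon F\to F'$ is sent to the morphism $[X,s]\mapsto[X,\varphi(s)]$, where $\varphi(s)(x)=\varphi_{G_x}(s(x))$. (c) For $F\in\mathcal F_{\mathcal D,R}$ and $G\in\mathcal G$, the maps $a\mapsto{}^ga$ make $M=\bigoplus_{H\in\Sigma_{\mathcal G}(G)}F(H)$ an $RG$-module. For $H\in\Sigma_{\mathcal G}(G)$ and $a\in F(H)$ there is a unique $G$-equivariant section $s_a$ of $F$ over $G/H$ with $s_a(H)=a$; put $[H,a]_G=[G/H,s_a]$. There is an isomorphism of $R$-modules between $F_+(G)$ and the $G$-cofixed points $M_G=M/IM$ of $M$ ($I$ the augmentation ideal of $RG$) under which $[H,a]_G$ corresponds to the class of $a$, for all $H\in\Sigma_{\mathcal G}(G)$ and $a\in F(H)$.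 -/

import Mathlib

open CategoryTheory

universe u v w

noncomputable section

namespace BisetPlus

/-! ## Subgroups of direct products -/

section Subgroups

variable {G H K : Type*} [Group G] [Group H] [Group K]

/-- The `*`-product `D * E` of `D ≤ G × H` and `E ≤ H × K`. -/
def star (D : Subgroup (G × H)) (E : Subgroup (H × K)) : Subgroup (G × K) where
  carrier := {x | ∃ h : H, (x.1, h) ∈ D ∧ (h, x.2) ∈ E}
  mul_mem' := by
    rintro a b ⟨h, h1, h2⟩ ⟨k, k1, k2⟩
    exact ⟨h * k, D.mul_mem h1 k1, E.mul_mem h2 k2⟩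
  one_mem' := ⟨1, D.one_mem, E.one_mem⟩
  inv_mem' := by
    rintro a ⟨h, h1, h2⟩
    exact ⟨h⁻¹, D.inv_mem h1, E.inv_mem h2⟩

/-- The subgroup `D * L ≤ G` for `D ≤ G × H` and `L ≤ H`. -/
def starSub (D : Subgroup (G × H)) (L : Subgroup H) : Subgroup G where
  carrier := {g | ∃ h ∈ L, (g, h) ∈ D}
  mul_mem' := by
    rintro a b ⟨h, h1, h2⟩ ⟨k, k1, k2⟩
    exact ⟨h * k, L.mul_mem h1 k1, D.mul_mem h2 k2⟩
  one_mem' := ⟨1, L.one_mem, D.one_mem⟩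
  inv_mem' := by
    rintro a ⟨h, h1, h2⟩
    exact ⟨h⁻¹, L.inv_mem h1, D.inv_mem h2⟩

/-- The first projection `p₁(D)` of `D ≤ G × H`. -/
def p₁ (D : Subgroup (G × H)) : Subgroup G := D.map (MonoidHom.fst G H)

variable (G) in
/-- The diagonal `Δ(G) ≤ G × G`. -/
def diag : Subgroup (G × G) := ((MonoidHom.id G).prod (MonoidHom.id G)).range

/-- The conjugate `ᵍA = g A g⁻¹`. -/
def conjSub (g : G) (A : Subgroup G) : Subgroup G := A.map (MulAut.conj g).toMonoidHom

/-- The twisted diagonal `{(g h g⁻¹, h)} ≤ G × G`, the `(g, 1)`-conjugate of the diagonal. -/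
def twDiag (g : G) : Subgroup (G × G) := conjSub ((g, 1) : G × G) (diag G)

theorem mem_star {D : Subgroup (G × H)} {E : Subgroup (H × K)} {x : G × K} :
    x ∈ star D E ↔ ∃ h : H, (x.1, h) ∈ D ∧ (h, x.2) ∈ E := Iff.rfl

theorem mem_starSub {D : Subgroup (G × H)} {L : Subgroup H} {g : G} :
    g ∈ starSub D L ↔ ∃ h ∈ L, (g, h) ∈ D := Iff.rfl

theorem mem_p₁ {D : Subgroup (G × H)} {g : G} : g ∈ p₁ D ↔ ∃ h, (g, h) ∈ D := by
  constructor
  · rintro ⟨⟨a, b⟩, h, rfl⟩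
    exact ⟨b, h⟩
  · rintro ⟨b, h⟩
    exact ⟨(g, b), h, rfl⟩

theorem mem_diag {x : G × G} : x ∈ diag G ↔ x.1 = x.2 := by
  constructor
  · rintro ⟨a, rfl⟩
    rfl
  · intro h
    exact ⟨x.1, Prod.ext rfl h⟩

theorem mem_conjSub {g x : G} {A : Subgroup G} : x ∈ conjSub g A ↔ g⁻¹ * x * g ∈ A := by
  constructor
  · rintro ⟨a, h, rfl⟩
    simpa [mul_assoc] using h
  · intro h
    exact ⟨_, h, by simp [mul_assoc]⟩

theorem mem_twDiag {g x y : G} : (x, y) ∈ twDiag g ↔ x = g * y * g⁻¹ := by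
  rw [twDiag, mem_conjSub, mem_diag]
  simp only [Prod.fst_mul, Prod.snd_mul, Prod.fst_inv, Prod.snd_inv, inv_one, one_mul, mul_one]
  constructor
  · rintro rfl
    group
  · rintro rfl
    group

theorem starSub_twDiag (g : G) (A : Subgroup G) : starSub (twDiag g) A = conjSub g A := by
  ext x
  rw [mem_starSub, mem_conjSub]
  constructor
  · rintro ⟨h, hA, hx⟩
    rw [mem_twDiag] at hx
    subst hx
    simpa [mul_assoc] using hA
  · intro h
    exact ⟨_, h, mem_twDiag.2 (by group)⟩

end Subgroups

/-! ## Finite groups on subsets of a fixed collection of elements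

A class of finite groups in which it makes sense to ask whether a subgroup of a member is again a
member, with no closure under isomorphism: a finite group is a finite set of elements of an
arbitrary type `α`, with a group structure, and a subgroup of it is again such a group. -/

/-- A finite group whose underlying set consists of elements of `α`. -/
structure FGrp (α : Type u) where
  carrier : Set α
  [grp : Group carrier]
  [fin : Finite carrier]

attribute [instance] FGrp.grp FGrp.fin

namespace FGrp

variable {α : Type u}

instance : CoeSort (FGrp α) (Type u) := ⟨fun G => G.carrier⟩

theorem ext' {G G' : FGrp α} (hc : G.carrier = G'.carrier)
    (hm : ∀ (a b : G) (a' b' : G'), a.1 = a'.1 → b.1 = b'.1 → (a * b).1 = (a' * b').1) :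
    G = G' := by
  obtain @⟨c, i, _⟩ := G
  obtain @⟨c', i', _⟩ := G'
  obtain rfl : c = c' := hc
  have : i = i' := by
    apply Group.ext
    funext a b
    exact Subtype.ext (hm a b a b rfl rfl)
  subst this
  rfl

/-- The elements of `G` lying in the subgroup `A`, as a set of elements of `α`. -/
def subEquiv (G : FGrp α) (A : Subgroup G) : ↥(Subtype.val '' (A : Set G)) ≃ A :=
  (Equiv.Set.image _ _ Subtype.val_injective).symm

/-- A subgroup of `G`, as a finite group in its own right. -/
def sub (G : FGrp α) (A : Subgroup G) : FGrp α where
  carrier := Subtype.val '' (A : Set G)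
  grp := (G.subEquiv A).group
  fin := Finite.of_equiv A (G.subEquiv A).symm

/-- The inclusion of a subgroup. -/
def incl (G : FGrp α) (A : Subgroup G) : G.sub A →* G :=
  A.subtype.comp (Equiv.mulEquiv (G.subEquiv A)).toMonoidHom

theorem incl_val (G : FGrp α) (A : Subgroup G) (a : G.sub A) : (G.incl A a).1 = a.1 := by
  have h := congrArg Subtype.val ((G.subEquiv A).symm_apply_apply a)
  exact h

theorem incl_injective (G : FGrp α) (A : Subgroup G) : Function.Injective (G.incl A) := by
  intro a b h
  apply Subtype.ext
  rw [← incl_val, ← incl_val, h]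

theorem incl_mem (G : FGrp α) (A : Subgroup G) (a : G.sub A) : G.incl A a ∈ A :=
  (G.subEquiv A a).2

theorem exists_incl (G : FGrp α) (A : Subgroup G) {x : G} (hx : x ∈ A) :
    ∃ a : G.sub A, G.incl A a = x :=
  ⟨⟨x.1, x, hx, rfl⟩, Subtype.ext (by rw [incl_val])⟩

theorem mul_val (G : FGrp α) (A : Subgroup G) (a b : G.sub A) :
    (a * b).1 = (G.incl A a * G.incl A b).1 := by
  rw [← incl_val, map_mul]

theorem sub_top (G : FGrp α) : G.sub ⊤ = G := by
  refine ext' ?_ ?_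
  · change Subtype.val '' ((⊤ : Subgroup G) : Set G) = _
    simp
  · intro a b a' b' ha hb
    rw [mul_val]
    congr 2
    · exact Subtype.ext (by rw [incl_val, ha])
    · exact Subtype.ext (by rw [incl_val, hb])

/-- A subgroup of a subgroup is a subgroup. -/
theorem sub_sub (G : FGrp α) (A : Subgroup G) (B : Subgroup (G.sub A)) (C : Subgroup G)
    (h : B.map (G.incl A) = C) : (G.sub A).sub B = G.sub C := by
  subst h
  refine ext' ?_ ?_
  · ext x
    constructor
    · rintro ⟨a, ha, rfl⟩
      exact ⟨G.incl A a, ⟨a, ha, rfl⟩, incl_val _ _ _⟩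
    · rintro ⟨_, ⟨a, ha, rfl⟩, rfl⟩
      exact ⟨a, ha, (incl_val _ _ _).symm⟩
  · intro a b a' b' ha hb
    rw [mul_val, mul_val, mul_val]
    congr 2
    · exact Subtype.ext (by rw [incl_val, incl_val, incl_val, ha])
    · exact Subtype.ext (by rw [incl_val, incl_val, incl_val, hb])

end FGrp

/-- For `D ≤ G × H`, `A ≤ G`, `B ≤ H`: the intersection `D ∩ (A × B)`, as a subgroup of
`A × B`. -/
def restr {α : Type u} {G H : FGrp α} (D : Subgroup (G × H)) (A : Subgroup G) (B : Subgroup H) :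
    Subgroup (G.sub A × H.sub B) :=
  D.comap ((G.incl A).prodMap (H.incl B))

/-- For `D ≤ G × H` and `A ≤ G`: the intersection `D ∩ (A × H)`, as a subgroup of `A × H`. -/
def restrL {α : Type u} {G H : FGrp α} (D : Subgroup (G × H)) (A : Subgroup G) :
    Subgroup (G.sub A × H) :=
  D.comap ((G.incl A).prodMap (MonoidHom.id H))

/-! ## Finite sets with a group action and the Burnside group -/

/-- A finite left `A`-set. -/
structure GSet (A : Type u) [Group A] where
  carrier : Type u
  [fin : Finite carrier]
  [act : MulAction A carrier]

attribute [instance] GSet.fin GSet.act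

instance (A : Type u) [Group A] : CoeSort (GSet A) (Type u) := ⟨fun X => X.carrier⟩

namespace GSet

section

variable {A : Type u} [Group A]

/-- An isomorphism of `A`-sets. -/
structure Iso (X Y : GSet A) where
  toEquiv : X ≃ Y
  map_smul : ∀ (a : A) (x : X), toEquiv (a • x) = a • toEquiv x

/-- Disjoint union of `A`-sets. -/
def sum (X Y : GSet A) : GSet A where
  carrier := X ⊕ Y
  act :=
    { smul := fun a => Sum.map (a • ·) (a • ·)
      one_smul := by rintro (x | x) <;> simp [HSMul.hSMul, Sum.map]; all_goals exact one_smul A x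
      mul_smul := by
        rintro a b (x | x)
        · exact congrArg Sum.inl (mul_smul a b x)
        · exact congrArg Sum.inr (mul_smul a b x) }

/-- The empty `A`-set. -/
def empty : GSet A where
  carrier := PEmpty
  act :=
    { smul := fun _ x => x
      one_smul := fun x => x.elim
      mul_smul := fun _ _ x => x.elim }

/-- The transitive `A`-set `A / D`. -/
def coset [Finite A] (D : Subgroup A) : GSet A where
  carrier := A ⧸ D

end

end GSet

/-- Isomorphism of finite `A`-sets. -/
def gsetSetoid (A : Type u) [Group A] : Setoid (GSet A) where
  r X Y := Nonempty (GSet.Iso X Y)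
  iseqv :=
    { refl := fun _ => ⟨⟨Equiv.refl _, fun _ _ => rfl⟩⟩
      symm := by
        rintro X Y ⟨e, he⟩
        exact ⟨⟨e.symm, fun a y => e.injective (by simp [he])⟩⟩
      trans := by
        rintro X Y Z ⟨e, he⟩ ⟨f, hf⟩
        exact ⟨⟨e.trans f, fun a x => by simp [he, hf]⟩⟩ }

/-- Isomorphism classes of finite `A`-sets. -/
def BMon (A : Type u) [Group A] : Type (u + 1) := Quotient (gsetSetoid A)

namespace BMon

variable {A : Type u} [Group A]

/-- The isomorphism class of a finite `A`-set. -/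
def mk (X : GSet A) : BMon A := Quotient.mk (gsetSetoid A) X

theorem sound {X Y : GSet A} (e : GSet.Iso X Y) : mk X = mk Y := Quotient.sound ⟨e⟩

instance : Zero (BMon A) := ⟨mk GSet.empty⟩

instance : Add (BMon A) := ⟨Quotient.map₂ GSet.sum (by
    rintro X X' ⟨e, he⟩ Y Y' ⟨f, hf⟩
    refine ⟨⟨Equiv.sumCongr e f, ?_⟩⟩
    rintro a (x | x)
    · exact congrArg Sum.inl (he a x)
    · exact congrArg Sum.inr (hf a x))⟩

/-- Addition of isomorphism classes is disjoint union. -/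
instance : AddCommMonoid (BMon A) where
  add_assoc := by
    rintro ⟨X⟩ ⟨Y⟩ ⟨Z⟩
    refine sound ⟨Equiv.sumAssoc _ _ _, ?_⟩
    rintro a ((x | x) | x) <;> rfl
  zero_add := by
    rintro ⟨X⟩
    refine sound ⟨Equiv.emptySum PEmpty _, ?_⟩
    rintro a (x | x)
    · exact x.elim
    · rfl
  add_zero := by
    rintro ⟨X⟩
    refine sound ⟨Equiv.sumEmpty _ PEmpty, ?_⟩
    rintro a (x | x)
    · rfl
    · exact x.elim
  add_comm := by
    rintro ⟨X⟩ ⟨Y⟩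
    refine sound ⟨Equiv.sumComm _ _, ?_⟩
    rintro a (x | x) <;> rfl
  nsmul := nsmulRec

theorem mk_add (X Y : GSet A) : mk X + mk Y = mk (X.sum Y) := rfl

theorem mk_empty : mk (GSet.empty : GSet A) = 0 := rfl

end BMon

/-- The Grothendieck group of finite `A`-sets with respect to disjoint unions. For `A = G × H`
this is the group `B(G, H)` of `(G, H)`-bisets: a `(G, H)`-biset is regarded as a left
`(G × H)`-set through `(g, h) u = g u h⁻¹`. -/
abbrev Burnside (A : Type u) [Group A] : Type (u + 1) := Algebra.GrothendieckAddGroup (BMon A)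

/-- The class `[X]` of a finite `A`-set in the Grothendieck group. -/
def cls {A : Type u} [Group A] (X : GSet A) : Burnside A :=
  Algebra.GrothendieckAddGroup.of (BMon.mk X)

section

variable {A : Type u} [Group A]

theorem lift_cls {B : Type*} [AddCommGroup B] (f : BMon A →+ B) (X : GSet A) :
    Algebra.GrothendieckAddGroup.lift f (cls X) = f (BMon.mk X) :=
  DFunLike.congr_fun (Algebra.GrothendieckAddGroup.lift.symm_apply_apply f) (BMon.mk X)

theorem cls_eq {X Y : GSet A} (e : GSet.Iso X Y) : cls X = cls Y := by
  rw [cls, BMon.sound e, cls]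

theorem cls_sum (X Y : GSet A) : cls (X.sum Y) = cls X + cls Y := by
  rw [cls, ← BMon.mk_add, map_add]
  rfl

theorem cls_empty : cls (GSet.empty : GSet A) = 0 := by
  rw [cls, BMon.mk_empty, map_zero]

theorem Burnside.hom_ext {B : Type*} [AddCommGroup B] {f g : Burnside A →+ B}
    (h : ∀ X, f (cls X) = g (cls X)) : f = g := by
  apply Algebra.GrothendieckAddGroup.lift.symm.injective
  ext ⟨X⟩
  exact h X

theorem Burnside.ind {p : Burnside A → Prop} (hc : ∀ X, p (cls X))
    (hs : ∀ x y, p x → p y → p (x - y)) (x : Burnside A) : p x := by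
  have key : ∀ x ∈ (⊤ : AddSubgroup (Burnside A)), x ∈ AddSubgroup.closure (Set.range (cls (A := A))) := by
    have : QuotientAddGroup.mk' (AddSubgroup.closure (Set.range (cls (A := A)))) = 0 := by
      apply Burnside.hom_ext
      intro X
      exact (QuotientAddGroup.eq_zero_iff _).2 (AddSubgroup.subset_closure ⟨X, rfl⟩)
    intro x _
    exact (QuotientAddGroup.eq_zero_iff _).1 (DFunLike.congr_fun this x)
  have h0 : p 0 := by simpa using hs _ _ (hc GSet.empty) (hc GSet.empty)
  have hn : ∀ x, p x → p (-x) := fun x hx => by simpa using hs _ _ h0 hx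
  refine AddSubgroup.closure_induction (p := fun x _ => p x) ?_ h0 ?_ ?_ (key x trivial)
  · rintro _ ⟨X, rfl⟩
    exact hc X
  · intro x y _ _ hx hy
    simpa using hs _ _ hx (hn _ hy)
  · intro x _ hx
    exact hn x hx

end

/-! ## Composition of bisets -/

section Tensor

variable {G H K L : Type u} [Group G] [Group H] [Group K] [Group L]

theorem one_one_smul {X : Type*} [MulAction (G × H) X] (x : X) : ((1, 1) : G × H) • x = x :=
  one_smul (G × H) x

/-- The `H`-orbit relation on `U × V`, for `h (u, v) = (u h⁻¹, h v)`. -/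
def tensSetoid (U : GSet (G × H)) (V : GSet (H × K)) : Setoid (U × V) where
  r a b := ∃ h : H, ((1, h) : G × H) • a.1 = b.1 ∧ ((h, 1) : H × K) • a.2 = b.2
  iseqv :=
    { refl := fun a => ⟨1, one_smul (G × H) _, one_smul (H × K) _⟩
      symm := by
        rintro ⟨u, v⟩ ⟨_, _⟩ ⟨h, rfl, rfl⟩
        exact ⟨h⁻¹, by simp [smul_smul, one_one_smul], by simp [smul_smul, one_one_smul]⟩
      trans := by
        rintro ⟨u, v⟩ ⟨_, _⟩ ⟨_, _⟩ ⟨h, rfl, rfl⟩ ⟨k, rfl, rfl⟩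
        exact ⟨k * h, by simp [smul_smul, one_one_smul], by simp [smul_smul, one_one_smul]⟩ }

/-- The `(G, K)`-biset `U ×_H V`. -/
def tens (U : GSet (G × H)) (V : GSet (H × K)) : GSet (G × K) where
  carrier := Quotient (tensSetoid U V)
  act :=
    { smul := fun a => Quotient.map
        (fun x => (((a.1, 1) : G × H) • x.1, ((1, a.2) : H × K) • x.2)) (by
          rintro ⟨u, v⟩ ⟨_, _⟩ ⟨h, rfl, rfl⟩
          exact ⟨h, by simp [smul_smul, one_one_smul], by simp [smul_smul, one_one_smul]⟩)
      one_smul := by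
        rintro ⟨u, v⟩
        exact congrArg (Quotient.mk _) (Prod.ext (one_smul (G × H) u) (one_smul (H × K) v))
      mul_smul := by
        rintro a b ⟨u, v⟩
        refine congrArg (Quotient.mk _) (Prod.ext ?_ ?_) <;> simp [smul_smul] }

/-- The element `[u, v]` of `U ×_H V`. -/
def tens.mk {U : GSet (G × H)} {V : GSet (H × K)} (u : U) (v : V) : tens U V :=
  Quotient.mk (tensSetoid U V) (u, v)

theorem tens.smul_mk {U : GSet (G × H)} {V : GSet (H × K)} (a : G × K) (u : U) (v : V) :
    a • (tens.mk u v) = tens.mk (((a.1, 1) : G × H) • u) (((1, a.2) : H × K) • v) := rfl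

theorem tens.mk_eq {U : GSet (G × H)} {V : GSet (H × K)} {u u' : U} {v v' : V} :
    tens.mk u v = tens.mk u' v' ↔
      ∃ h : H, ((1, h) : G × H) • u = u' ∧ ((h, 1) : H × K) • v = v' := by
  unfold tens.mk
  exact Quotient.eq

theorem tens.ind {U : GSet (G × H)} {V : GSet (H × K)} {p : tens U V → Prop}
    (h : ∀ u v, p (tens.mk u v)) (x : tens U V) : p x := by
  induction x using Quotient.ind with
  | _ a => exact h a.1 a.2

theorem tens.stabilizer_mk {U : GSet (G × H)} {V : GSet (H × K)} (u : U) (v : V) :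
    MulAction.stabilizer (G × K) (tens.mk u v) =
      star (MulAction.stabilizer (G × H) u) (MulAction.stabilizer (H × K) v) := by
  ext ⟨g, k⟩
  rw [MulAction.mem_stabilizer_iff, tens.smul_mk, tens.mk_eq, mem_star]
  simp only [smul_smul, MulAction.mem_stabilizer_iff]
  constructor
  · rintro ⟨h, h1, h2⟩
    exact ⟨h, by simpa using h1, by simpa using h2⟩
  · rintro ⟨h, h1, h2⟩
    exact ⟨h, by simpa using h1, by simpa using h2⟩

/-- Functoriality of `U ×_H V` for isomorphisms. -/
def tensCongr {U U' : GSet (G × H)} {V V' : GSet (H × K)} (e : GSet.Iso U U')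
    (f : GSet.Iso V V') : GSet.Iso (tens U V) (tens U' V') where
  toEquiv := Quotient.congr (Equiv.prodCongr e.toEquiv f.toEquiv) (by
    rintro ⟨u, v⟩ ⟨u', v'⟩
    refine exists_congr fun h => ?_
    simp only [Equiv.prodCongr_apply, Prod.map_apply, ← e.map_smul, ← f.map_smul,
      EmbeddingLike.apply_eq_iff_eq])
  map_smul := by
    rintro a ⟨u, v⟩
    refine congrArg (Quotient.mk _) (Prod.ext ?_ ?_)
    · exact e.map_smul _ _
    · exact f.map_smul _ _

/-- A bijective equivariant map is an isomorphism. -/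
def GSet.isoOfBijective {A : Type u} [Group A] {X Y : GSet A} (f : X → Y)
    (hf : Function.Bijective f) (hs : ∀ (a : A) x, f (a • x) = a • f x) : GSet.Iso X Y :=
  ⟨Equiv.ofBijective f hf, hs⟩

theorem tens_sum_left (U U' : GSet (G × H)) (V : GSet (H × K)) :
    Nonempty (GSet.Iso (tens (U.sum U') V) ((tens U V).sum (tens U' V))) := by
  refine ⟨⟨⟨Quotient.lift (fun x => Sum.map (fun u => tens.mk u x.2) (fun u => tens.mk u x.2) x.1)
    ?_, Sum.elim (Quotient.map (fun x => (Sum.inl x.1, x.2)) ?_)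
      (Quotient.map (fun x => (Sum.inr x.1, x.2)) ?_), ?_, ?_⟩, ?_⟩⟩
  · rintro ⟨u | u, v⟩ ⟨_, _⟩ ⟨h, rfl, rfl⟩
    · exact congrArg Sum.inl (tens.mk_eq.2 ⟨h, rfl, rfl⟩)
    · exact congrArg Sum.inr (tens.mk_eq.2 ⟨h, rfl, rfl⟩)
  · rintro ⟨u, v⟩ ⟨_, _⟩ ⟨h, rfl, rfl⟩
    exact ⟨h, rfl, rfl⟩
  · rintro ⟨u, v⟩ ⟨_, _⟩ ⟨h, rfl, rfl⟩
    exact ⟨h, rfl, rfl⟩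
  · rintro ⟨u | u, v⟩ <;> rfl
  · rintro (⟨u, v⟩ | ⟨u, v⟩) <;> rfl
  · rintro a ⟨u | u, v⟩ <;> rfl

theorem tens_sum_right (U : GSet (G × H)) (V V' : GSet (H × K)) :
    Nonempty (GSet.Iso (tens U (V.sum V')) ((tens U V).sum (tens U V'))) := by
  refine ⟨⟨⟨Quotient.lift (fun x => Sum.map (fun v => tens.mk x.1 v) (fun v => tens.mk x.1 v) x.2)
    ?_, Sum.elim (Quotient.map (fun x => (x.1, Sum.inl x.2)) ?_)
      (Quotient.map (fun x => (x.1, Sum.inr x.2)) ?_), ?_, ?_⟩, ?_⟩⟩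
  · rintro ⟨u, v | v⟩ ⟨_, _⟩ ⟨h, rfl, rfl⟩
    · exact congrArg Sum.inl (tens.mk_eq.2 ⟨h, rfl, rfl⟩)
    · exact congrArg Sum.inr (tens.mk_eq.2 ⟨h, rfl, rfl⟩)
  · rintro ⟨u, v⟩ ⟨_, _⟩ ⟨h, rfl, rfl⟩
    exact ⟨h, rfl, rfl⟩
  · rintro ⟨u, v⟩ ⟨_, _⟩ ⟨h, rfl, rfl⟩
    exact ⟨h, rfl, rfl⟩
  · rintro ⟨u, v | v⟩ <;> rfl
  · rintro (⟨u, v⟩ | ⟨u, v⟩) <;> rfl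
  · rintro a ⟨u, v | v⟩ <;> rfl

theorem tens_empty_left (V : GSet (H × K)) :
    Nonempty (GSet.Iso (tens (GSet.empty : GSet (G × H)) V) GSet.empty) := by
  have : IsEmpty (tens (GSet.empty : GSet (G × H)) V) :=
    ⟨fun x => tens.ind (p := fun _ => False) (fun u _ => PEmpty.elim u) x⟩
  exact ⟨⟨⟨fun x => isEmptyElim x, fun x => PEmpty.elim x, fun x => isEmptyElim x,
    fun x => PEmpty.elim x⟩, fun _ x => isEmptyElim x⟩⟩

theorem tens_empty_right (U : GSet (G × H)) :
    Nonempty (GSet.Iso (tens U (GSet.empty : GSet (H × K))) GSet.empty) := by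
  have : IsEmpty (tens U (GSet.empty : GSet (H × K))) :=
    ⟨fun x => tens.ind (p := fun _ => False) (fun _ v => PEmpty.elim v) x⟩
  exact ⟨⟨⟨fun x => isEmptyElim x, fun x => PEmpty.elim x, fun x => isEmptyElim x,
    fun x => PEmpty.elim x⟩, fun _ x => isEmptyElim x⟩⟩

theorem tens_assoc (U : GSet (G × H)) (V : GSet (H × K)) (W : GSet (K × L)) :
    Nonempty (GSet.Iso (tens (tens U V) W) (tens U (tens V W))) := by
  refine ⟨⟨⟨Quotient.lift (fun x => Quotient.lift (fun y => tens.mk y.1 (tens.mk y.2 x.2)) ?_ x.1)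
    ?_, Quotient.lift (fun x => Quotient.lift (fun y => tens.mk (tens.mk x.1 y.1) y.2) ?_ x.2)
    ?_, ?_, ?_⟩, ?_⟩⟩
  · rintro ⟨u, v⟩ ⟨_, _⟩ ⟨h, rfl, rfl⟩
    refine tens.mk_eq.2 ⟨h, rfl, ?_⟩
    rw [tens.smul_mk]
    exact congrArg _ (one_smul (K × L) _)
  · rintro ⟨⟨u, v⟩, z⟩ ⟨_, _⟩ ⟨k, rfl, rfl⟩
    refine tens.mk_eq.2 ⟨1, rfl, ?_⟩
    rw [tens.smul_mk]
    exact tens.mk_eq.2 ⟨k, by simp [smul_smul, one_one_smul], by simp [smul_smul, one_one_smul]⟩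
  · rintro ⟨v, z⟩ ⟨_, _⟩ ⟨k, rfl, rfl⟩
    refine tens.mk_eq.2 ⟨k, ?_, rfl⟩
    rw [tens.smul_mk]
    exact congrArg (fun t => tens.mk t _) (one_smul (G × H) _)
  · rintro ⟨u, ⟨v, z⟩⟩ ⟨_, _⟩ ⟨h, rfl, rfl⟩
    refine tens.mk_eq.2 ⟨1, ?_, rfl⟩
    rw [tens.smul_mk]
    exact tens.mk_eq.2 ⟨h, by simp [smul_smul, one_one_smul], by simp [smul_smul, one_one_smul]⟩
  · rintro ⟨⟨u, v⟩, z⟩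
    rfl
  · rintro ⟨u, ⟨v, z⟩⟩
    rfl
  · rintro a ⟨⟨u, v⟩, z⟩
    rfl

variable (G) in
/-- The group `G` as a `(G, G)`-biset, by left and right multiplication. -/
def regular [Finite G] : GSet (G × G) where
  carrier := G
  act :=
    { smul := fun a x => a.1 * x * a.2⁻¹
      one_smul := fun x => show (1 : G) * x * 1⁻¹ = x by simp
      mul_smul := fun a b x =>
        show a.1 * b.1 * x * (a.2 * b.2)⁻¹ = a.1 * (b.1 * x * b.2⁻¹) * a.2⁻¹ by
          simp [mul_assoc] }

theorem regular_smul [Finite G] (a b x : G) :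
    ((a, b) : G × G) • (show regular G from x) = (show regular G from (a * x * b⁻¹ : G)) := rfl

theorem regular_tens [Finite G] (U : GSet (G × H)) :
    Nonempty (GSet.Iso (tens (regular G) U) U) := by
  refine ⟨⟨⟨Quotient.lift (fun x : G × U => ((x.1, 1) : G × H) • x.2) ?_,
    fun u => tens.mk (U := regular G) (1 : G) u, ?_, ?_⟩, ?_⟩⟩
  · rintro ⟨(g : G), u⟩ ⟨_, _⟩ ⟨h, rfl, rfl⟩
    change ((g, 1) : G × H) • u = ((1 * g * h⁻¹, 1) : G × H) • ((h, 1) : G × H) • u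
    simp [smul_smul]
  · rintro ⟨(g : G), u⟩
    refine tens.mk_eq.2 ⟨g⁻¹, ?_, ?_⟩
    · change 1 * 1 * g⁻¹⁻¹ = g
      simp
    · change ((g⁻¹, 1) : G × H) • ((g, 1) : G × H) • u = u
      simp [smul_smul, one_one_smul]
  · intro u
    exact one_smul (G × H) u
  · rintro ⟨a, b⟩ ⟨(g : G), u⟩
    change ((a * g * 1⁻¹, 1) : G × H) • (((1, b) : G × H) • u) = (a, b) • ((g, 1) : G × H) • u
    simp [smul_smul]

theorem tens_regular [Finite H] (U : GSet (G × H)) :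
    Nonempty (GSet.Iso (tens U (regular H)) U) := by
  refine ⟨⟨⟨Quotient.lift (fun x : U × H => ((1, x.2⁻¹) : G × H) • x.1) ?_,
    fun u => tens.mk (V := regular H) u (1 : H), ?_, ?_⟩, ?_⟩⟩
  · rintro ⟨u, (g : H)⟩ ⟨_, _⟩ ⟨h, rfl, rfl⟩
    change ((1, g⁻¹) : G × H) • u = ((1, (h * g * 1⁻¹)⁻¹) : G × H) • ((1, h) : G × H) • u
    simp [smul_smul]
  · rintro ⟨u, (g : H)⟩
    refine tens.mk_eq.2 ⟨g, ?_, ?_⟩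
    · change ((1, g) : G × H) • ((1, g⁻¹) : G × H) • u = u
      simp [smul_smul, one_one_smul]
    · change g * 1 * 1⁻¹ = g
      simp
  · intro u
    change ((1, (1 : H)⁻¹) : G × H) • u = u
    rw [inv_one]
    exact one_smul (G × H) u
  · rintro ⟨a, b⟩ ⟨u, (g : H)⟩
    change ((1, (1 * g * b⁻¹)⁻¹) : G × H) • (((a, 1) : G × H) • u)
      = (a, b) • ((1, g⁻¹) : G × H) • u
    simp [smul_smul]

/-- The product of isomorphism classes of bisets. -/
def tensMon (x : BMon (G × H)) : BMon (H × K) →+ BMon (G × K) where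
  toFun := Quotient.map₂ tens (by
    rintro U U' ⟨e⟩ V V' ⟨f⟩
    exact ⟨tensCongr e f⟩) x
  map_zero' := by
    obtain ⟨U⟩ := x
    exact BMon.sound (tens_empty_right U).some
  map_add' := by
    rintro ⟨V⟩ ⟨V'⟩
    obtain ⟨U⟩ := x
    exact BMon.sound (tens_sum_right U V V').some

/-- The bilinear product `B(G, H) × B(H, K) → B(G, K)` induced by `(U, V) ↦ U ×_H V`. -/
def comp : Burnside (G × H) →+ Burnside (H × K) →+ Burnside (G × K) :=
  Algebra.GrothendieckAddGroup.lift
    { toFun := fun x => Algebra.GrothendieckAddGroup.lift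
        ((Algebra.GrothendieckAddGroup.of (M := BMon (G × K))).comp (tensMon x))
      map_zero' := by
        apply Burnside.hom_ext
        intro V
        rw [lift_cls]
        exact (cls_eq (tens_empty_left V).some).trans cls_empty
      map_add' := by
        rintro ⟨U⟩ ⟨U'⟩
        apply Burnside.hom_ext
        intro V
        rw [lift_cls, AddMonoidHom.add_apply, lift_cls, lift_cls]
        exact (cls_eq (tens_sum_left U U' V).some).trans (cls_sum _ _) }

theorem comp_cls (U : GSet (G × H)) (V : GSet (H × K)) :
    comp (cls U) (cls V) = cls (tens U V) := by
  rw [comp, lift_cls]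
  exact lift_cls _ V

theorem comp_assoc (x : Burnside (G × H)) (y : Burnside (H × K)) (z : Burnside (K × L)) :
    comp (comp x y) z = comp x (comp y z) := by
  induction x using Burnside.ind with
  | hs x x' hx hx' => simp only [map_sub, AddMonoidHom.sub_apply, hx, hx']
  | hc U =>
  induction y using Burnside.ind with
  | hs x x' hx hx' => simp only [map_sub, AddMonoidHom.sub_apply, hx, hx']
  | hc V =>
  induction z using Burnside.ind with
  | hs x x' hx hx' => simp only [map_sub, hx, hx']
  | hc W =>
  simp only [comp_cls]
  exact cls_eq (tens_assoc U V W).some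

theorem regular_comp [Finite G] (x : Burnside (G × H)) : comp (cls (regular G)) x = x := by
  induction x using Burnside.ind with
  | hs x x' hx hx' => simp only [map_sub, hx, hx']
  | hc U => rw [comp_cls]; exact cls_eq (regular_tens U).some

theorem comp_regular [Finite H] (x : Burnside (G × H)) : comp x (cls (regular H)) = x := by
  induction x using Burnside.ind with
  | hs x x' hx hx' => simp only [map_sub, AddMonoidHom.sub_apply, hx, hx']
  | hc U => rw [comp_cls]; exact cls_eq (tens_regular U).some

end Tensor

/-! ## The class of a biset with prescribed point stabilizers -/

section Orbits

variable {A : Type u} [Group A] [Finite A]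

/-- A subset of an `A`-set that is stable under the action, as an `A`-set. -/
def GSet.ofSet (X : GSet A) (s : Set X) (hs : ∀ (a : A), ∀ x ∈ s, a • x ∈ s) : GSet A where
  carrier := s
  act :=
    { smul := fun a x => ⟨a • x.1, hs a x.1 x.2⟩
      one_smul := fun x => Subtype.ext (one_smul A x.1)
      mul_smul := fun a b x => Subtype.ext (mul_smul a b x.1) }

/-- If all point stabilizers of `X` lie in `T`, then `[X]` is a sum of classes `[A / D]` with
`D ∈ T`. -/
theorem cls_mem_closure (T : Set (Subgroup A)) (X : GSet A)
    (hX : ∀ x : X, MulAction.stabilizer A x ∈ T) :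
    cls X ∈ AddSubgroup.closure {b | ∃ D ∈ T, b = cls (GSet.coset D)} := by
  classical
  induction hn : Nat.card X using Nat.strong_induction_on generalizing X with
  | _ n ih =>
  subst hn
  rcases isEmpty_or_nonempty X with he | ⟨⟨x⟩⟩
  · have e : GSet.Iso X GSet.empty :=
      ⟨⟨fun x => isEmptyElim x, fun x => PEmpty.elim x, fun x => isEmptyElim x,
        fun x => PEmpty.elim x⟩, fun _ x => isEmptyElim x⟩
    rw [cls_eq e, cls_empty]
    exact zero_mem _
  · let O : Set X := MulAction.orbit A x
    have hO : ∀ (a : A), ∀ y ∈ O, a • y ∈ O := fun a y hy => by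
      exact MulAction.mem_orbit_of_mem_orbit a hy
    have hOc : ∀ (a : A), ∀ y ∈ Oᶜ, a • y ∈ Oᶜ := fun a y hy h => hy (by
      have := hO a⁻¹ _ h
      rwa [inv_smul_smul] at this)
    have e : GSet.Iso ((X.ofSet O hO).sum (X.ofSet Oᶜ hOc)) X :=
      ⟨Equiv.Set.sumCompl O, by rintro a (y | y) <;> rfl⟩
    have e' : GSet.Iso (GSet.coset (MulAction.stabilizer A x)) (X.ofSet O hO) := by
      refine GSet.isoOfBijective (fun q => ⟨MulAction.ofQuotientStabilizer A x q,
        MulAction.ofQuotientStabilizer_mem_orbit A x q⟩) ⟨?_, ?_⟩ ?_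
      · intro p q h
        exact MulAction.injective_ofQuotientStabilizer A x (congrArg Subtype.val h)
      · rintro ⟨_, a, rfl⟩
        exact ⟨(a : A ⧸ MulAction.stabilizer A x), rfl⟩
      · intro a q
        exact Subtype.ext (MulAction.ofQuotientStabilizer_smul A x a q)
    rw [← cls_eq e, cls_sum, ← cls_eq e']
    refine add_mem (AddSubgroup.subset_closure ⟨_, hX x, rfl⟩) (ih _ ?_ _ ?_ rfl)
    · have h1 : Nat.card (X.ofSet Oᶜ hOc) = Nat.card (Oᶜ : Set X) := rfl
      rw [h1]
      refine lt_of_lt_of_eq (Set.ncard_lt_ncard (t := Set.univ) ?_) (Set.ncard_univ X)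
      refine Set.ssubset_univ_iff.2 fun h => ?_
      have : x ∈ Oᶜ := h ▸ Set.mem_univ x
      exact this (MulAction.mem_orbit_self x)
    · intro y
      have : MulAction.stabilizer A y = MulAction.stabilizer A y.1 := by
        ext a
        exact Subtype.ext_iff
      rw [this]
      exact hX y.1

theorem stabilizer_coset (D : Subgroup A) (a : A) :
    MulAction.stabilizer A (show GSet.coset D from (a : A ⧸ D)) = conjSub a D := by
  ext x
  rw [MulAction.mem_stabilizer_iff, mem_conjSub]
  change ((x * a : A) : A ⧸ D) = _ ↔ _
  rw [eq_comm, QuotientGroup.eq, mul_assoc]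

end Orbits

/-! ## The data `(𝒢, 𝒮)` and the categories `𝒟 = 𝒞(𝒢, 𝒮)` and `𝒟₊` -/

/-- A class `𝒢` of finite groups together with sets `𝒮(G, H)` of subgroups of `G × H` for
`G, H ∈ 𝒢`, satisfying (i) `Δ(G) ∈ 𝒮(G, G)`; (ii) `𝒮(G, H)` is closed under conjugation;
(iii) `D ∈ 𝒮(G, H)`, `E ∈ 𝒮(H, K)` imply `D * E ∈ 𝒮(G, K)`. (Values of `S` at groups outside
`𝒢` play no role.) -/
structure BisetSystem (α : Type u) where
  mem : Set (FGrp α)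
  S : ∀ G H : FGrp α, Set (Subgroup (G × H))
  diag_mem : ∀ G ∈ mem, diag G ∈ S G G
  conj_mem : ∀ G ∈ mem, ∀ H ∈ mem, ∀ D ∈ S G H, ∀ x : G × H, conjSub x D ∈ S G H
  star_mem : ∀ G ∈ mem, ∀ H ∈ mem, ∀ K ∈ mem, ∀ D ∈ S G H, ∀ E ∈ S H K, star D E ∈ S G K

namespace BisetSystem

variable {α : Type u} (P : BisetSystem α)

/-- Closure under restriction: for `D ∈ 𝒮(G, H)` and a subgroup `K ≤ H` with `K ∈ 𝒢`, one has `D * K ∈ 𝒢`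
and `D * Δ(K) = D ∩ (G × K)` belongs to `𝒮(D * K, K)`. (As `p₁(D ∩ (G × K)) = D * K`, this is
`D ∩ ((D * K) × K)`.) -/
class RestrictionClosed : Prop where
  out : ∀ G ∈ P.mem, ∀ H ∈ P.mem, ∀ D ∈ P.S G H, ∀ K : Subgroup H, H.sub K ∈ P.mem →
    G.sub (starSub D K) ∈ P.mem ∧ restr D (starSub D K) K ∈ P.S (G.sub (starSub D K)) (H.sub K)

/-- The sets `𝒮₊(G, H)`: all `D ≤ G × H` with `p₁(D) ∈ 𝒢` and `D ∈ 𝒮(p₁(D), H)`. -/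
def SPlus (G H : FGrp α) : Set (Subgroup (G × H)) :=
  {D | G.sub (p₁ D) ∈ P.mem ∧ restrL D (p₁ D) ∈ P.S (G.sub (p₁ D)) H}

variable {P}

theorem S_congr {A A' B B' : FGrp α} (hA : A = A') (hB : B = B') {D : Subgroup (A × B)}
    {D' : Subgroup (A' × B')}
    (h : ∀ (a : A) (b : B) (a' : A') (b' : B'), a.1 = a'.1 → b.1 = b'.1 →
      ((a, b) ∈ D ↔ (a', b') ∈ D')) (hD : D ∈ P.S A B) : D' ∈ P.S A' B' := by
  subst hA hB
  have : D = D' := by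
    ext ⟨a, b⟩
    exact h a b a b rfl rfl
  exact this ▸ hD

theorem mem_restr {G H : FGrp α} {D : Subgroup (G × H)} {A : Subgroup G} {B : Subgroup H}
    {a : G.sub A} {b : H.sub B} : (a, b) ∈ restr D A B ↔ (G.incl A a, H.incl B b) ∈ D := Iff.rfl

theorem mem_restrL {G H : FGrp α} {D : Subgroup (G × H)} {A : Subgroup G}
    {a : G.sub A} {b : H} : (a, b) ∈ restrL D A ↔ (G.incl A a, b) ∈ D := Iff.rfl

section

variable [hP : P.RestrictionClosed]

/-- For `D ∈ 𝒮₊(G, H)` and `K ≤ H` with `K ∈ 𝒢`, one has `D * K ∈ 𝒢` and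
`D * Δ(K) ∈ 𝒮(D * K, K)`. -/
theorem SPlus_restr {G H : FGrp α} (hH : H ∈ P.mem) {D : Subgroup (G × H)}
    (hD : D ∈ P.SPlus G H) (K : Subgroup H) (hK : H.sub K ∈ P.mem) :
    G.sub (starSub D K) ∈ P.mem ∧
      restr D (starSub D K) K ∈ P.S (G.sub (starSub D K)) (H.sub K) := by
  obtain ⟨h1, h2⟩ := hD
  obtain ⟨h3, h4⟩ := hP.out _ h1 _ hH _ h2 K hK
  have e : (G.sub (p₁ D)).sub (starSub (restrL D (p₁ D)) K) = G.sub (starSub D K) := by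
    apply FGrp.sub_sub
    ext x
    constructor
    · rintro ⟨a, ⟨k, hk, hak⟩, rfl⟩
      exact ⟨k, hk, hak⟩
    · rintro ⟨k, hk, hak⟩
      obtain ⟨a, rfl⟩ := G.exists_incl (p₁ D) (mem_p₁.2 ⟨k, hak⟩)
      exact ⟨a, ⟨k, hk, hak⟩, rfl⟩
  refine ⟨e ▸ h3, S_congr e rfl ?_ h4⟩
  rintro a b a' b' ha hb
  obtain rfl : b = b' := Subtype.ext hb
  rw [mem_restr, mem_restr, mem_restrL]
  have : G.incl _ (FGrp.incl _ _ a) = G.incl _ a' :=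
    Subtype.ext (by rw [FGrp.incl_val, FGrp.incl_val, FGrp.incl_val, ha])
  rw [this]

theorem SPlus_diag (G : FGrp α) (hG : G ∈ P.mem) : diag G ∈ P.SPlus G G := by
  have h : p₁ (diag G) = ⊤ := by
    rw [eq_top_iff]
    intro x _
    exact mem_p₁.2 ⟨x, mem_diag.2 rfl⟩
  have e : G.sub (p₁ (diag G)) = G := by rw [h, FGrp.sub_top]
  refine ⟨e.symm ▸ hG, S_congr e.symm rfl ?_ (P.diag_mem G hG)⟩
  intro a b a' b' ha hb
  rw [mem_restrL, mem_diag, mem_diag]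
  simp only [Subtype.ext_iff, FGrp.incl_val, ha, hb]

theorem twDiag_mem (G : FGrp α) (hG : G ∈ P.mem) (g : G) : twDiag g ∈ P.S G G :=
  P.conj_mem G hG G hG _ (P.diag_mem G hG) _

/-- Conjugation by `g` is in the category: `A ∈ 𝒢` implies `ᵍA ∈ 𝒢`, and
`{(g a g⁻¹, a)} ∈ 𝒮(ᵍA, A)`. -/
theorem conj_restr (G : FGrp α) (hG : G ∈ P.mem) (g : G) (A : Subgroup G)
    (hA : G.sub A ∈ P.mem) : G.sub (conjSub g A) ∈ P.mem ∧
      restr (twDiag g) (conjSub g A) A ∈ P.S (G.sub (conjSub g A)) (G.sub A) := by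
  have := hP.out G hG G hG _ (twDiag_mem G hG g) A hA
  rwa [starSub_twDiag] at this

theorem SPlus_conj {G H : FGrp α} (hG : G ∈ P.mem) (hH : H ∈ P.mem) {D : Subgroup (G × H)}
    (hD : D ∈ P.SPlus G H) (x : G × H) : conjSub x D ∈ P.SPlus G H := by
  obtain ⟨h1, h2⟩ := hD
  obtain ⟨g, h⟩ := x
  have e : conjSub g (p₁ D) = p₁ (conjSub (g, h) D) := by
    ext y
    rw [mem_conjSub, mem_p₁, mem_p₁]
    constructor
    · rintro ⟨k, hk⟩
      exact ⟨h * k * h⁻¹, mem_conjSub.2 (by simpa [mul_assoc] using hk)⟩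
    · rintro ⟨k, hk⟩
      exact ⟨h⁻¹ * k * h, by simpa using mem_conjSub.1 hk⟩
  obtain ⟨h3, h4⟩ := conj_restr G hG g _ h1
  have h5 := P.conj_mem _ h3 _ hH _ (P.star_mem _ h3 _ h1 _ hH _ h4 _ h2) (1, h)
  have e' := congrArg G.sub e
  refine ⟨e' ▸ h3, S_congr e' rfl ?_ h5⟩
  intro a b a' b' ha hb
  obtain rfl : b = b' := Subtype.ext hb
  have ea : G.incl _ a = G.incl _ a' :=
    Subtype.ext (by rw [FGrp.incl_val, FGrp.incl_val, ha])
  rw [mem_restrL, mem_conjSub, mem_conjSub, ← ea, mem_star]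
  simp only [Prod.fst_mul, Prod.snd_mul, Prod.fst_inv, Prod.snd_inv, inv_one, one_mul, mul_one,
    Prod.inv_mk, Prod.mk_mul_mk]
  constructor
  · rintro ⟨c, hc, hc'⟩
    rw [mem_restr, mem_twDiag] at hc
    rw [mem_restrL] at hc'
    rw [hc]
    simpa [mul_assoc] using hc'
  · intro hk
    obtain ⟨c, hc⟩ := G.exists_incl (p₁ D) (mem_p₁.2 ⟨_, hk⟩)
    refine ⟨c, ?_, ?_⟩
    · rw [mem_restr, mem_twDiag, hc]
      group
    · rw [mem_restrL, hc]
      exact hk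

theorem SPlus_star {G H K : FGrp α} (hH : H ∈ P.mem) (hK : K ∈ P.mem)
    {D : Subgroup (G × H)} (hD : D ∈ P.SPlus G H) {E : Subgroup (H × K)}
    (hE : E ∈ P.SPlus H K) : star D E ∈ P.SPlus G K := by
  obtain ⟨h1, h2⟩ := hE
  obtain ⟨h3, h4⟩ := SPlus_restr hH hD _ h1
  have h5 := P.star_mem _ h3 _ h1 _ hK _ h4 _ h2
  have e : starSub D (p₁ E) = p₁ (star D E) := by
    ext x
    rw [mem_starSub, mem_p₁]
    constructor
    · rintro ⟨h, hh, hx⟩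
      obtain ⟨k, hk⟩ := mem_p₁.1 hh
      exact ⟨k, h, hx, hk⟩
    · rintro ⟨k, h, hx, hk⟩
      exact ⟨h, mem_p₁.2 ⟨k, hk⟩, hx⟩
  have e' := congrArg G.sub e
  refine ⟨e' ▸ h3, S_congr e' rfl ?_ h5⟩
  intro a b a' b' ha hb
  obtain rfl : b = b' := Subtype.ext hb
  have ea : G.incl _ a = G.incl _ a' :=
    Subtype.ext (by rw [FGrp.incl_val, FGrp.incl_val, ha])
  rw [mem_restrL, mem_star, mem_star, ← ea]
  constructor
  · rintro ⟨c, hc, hc'⟩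
    exact ⟨H.incl _ c, hc, hc'⟩
  · rintro ⟨h, hh, hk⟩
    obtain ⟨c, rfl⟩ := H.exists_incl (p₁ E) (mem_p₁.2 ⟨_, hk⟩)
    exact ⟨c, hh, hk⟩

variable (P) in
/-- The data `(𝒢, 𝒮₊)`. -/
def plus : BisetSystem α where
  mem := P.mem
  S := P.SPlus
  diag_mem := SPlus_diag
  conj_mem _ hG _ hH _ hD := SPlus_conj hG hH hD
  star_mem _ _ _ hH _ hK _ hD _ hE := SPlus_star hH hK hD hE

end

variable (P) in
/-- The objects of `𝒟 = 𝒞(𝒢, 𝒮)`: the groups in `𝒢`. -/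
structure Obj where
  grp : FGrp α
  mem : grp ∈ P.mem

instance : CoeSort P.Obj (Type u) := ⟨fun G => G.grp.carrier⟩

/-- `Hom(H, G)` in `𝒟`: the subgroup of `B(G, H)` generated by the classes of `(G × H) / D` for
`D ∈ 𝒮(G, H)`. -/
def homSubgroup (H G : P.Obj) : AddSubgroup (Burnside (G × H)) :=
  AddSubgroup.closure {b | ∃ D ∈ P.S G.grp H.grp, b = cls (GSet.coset D)}

theorem cls_mem_hom {G H : P.Obj} (U : GSet (G × H))
    (hU : ∀ u : U, MulAction.stabilizer (G × H) u ∈ P.S G.grp H.grp) :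
    cls U ∈ homSubgroup H G := cls_mem_closure _ U hU

theorem stabilizer_coset_mem {G H : P.Obj} {D : Subgroup (G × H)} (hD : D ∈ P.S G.grp H.grp)
    (u : GSet.coset D) : MulAction.stabilizer (G × H) u ∈ P.S G.grp H.grp := by
  obtain ⟨a, rfl⟩ := QuotientGroup.mk_surjective u
  have h := stabilizer_coset D a
  exact h ▸ P.conj_mem _ G.mem _ H.mem _ hD a

theorem comp_mem_hom {G H K : P.Obj} {x : Burnside (G × H)} {y : Burnside (H × K)}
    (hx : x ∈ homSubgroup H G) (hy : y ∈ homSubgroup K H) : comp x y ∈ homSubgroup K G := by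
  induction hx using AddSubgroup.closure_induction with
  | zero => simp
  | add a b _ _ ha hb => simpa using add_mem ha hb
  | neg a _ ha => simpa using ha
  | mem x hx =>
  obtain ⟨D, hD, rfl⟩ := hx
  induction hy using AddSubgroup.closure_induction with
  | zero => simp
  | add a b _ _ ha hb => simpa using add_mem ha hb
  | neg a _ ha => simpa using ha
  | mem y hy =>
  obtain ⟨E, hE, rfl⟩ := hy
  rw [comp_cls]
  apply cls_mem_hom
  intro x
  induction x using tens.ind with
  | _ u v =>
  rw [tens.stabilizer_mk]
  exact P.star_mem _ G.mem _ H.mem _ K.mem _ (stabilizer_coset_mem hD u) _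
    (stabilizer_coset_mem hE v)

theorem regular_mem_hom (G : P.Obj) : cls (regular G) ∈ homSubgroup G G := by
  apply cls_mem_hom
  intro (x : G)
  have : MulAction.stabilizer (G × G) (show regular G from x) = twDiag x := by
    ext ⟨a, b⟩
    rw [MulAction.mem_stabilizer_iff, mem_twDiag]
    change a * x * b⁻¹ = x ↔ _
    constructor
    · intro h
      rw [mul_inv_eq_iff_eq_mul] at h
      rw [← h]
      group
    · rintro rfl
      group
  rw [this]
  exact P.conj_mem _ G.mem _ G.mem _ (P.diag_mem _ G.mem) _

/-- The category `𝒟 = 𝒞(𝒢, 𝒮)`: identities are the classes of the bisets `G`, and composition is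
induced by `(U, V) ↦ U ×_H V`. -/
instance : Category.{u + 1} P.Obj where
  Hom H G := homSubgroup H G
  id G := ⟨cls (regular G), regular_mem_hom G⟩
  comp f g := ⟨comp g.1 f.1, comp_mem_hom g.2 f.2⟩
  id_comp f := Subtype.ext (comp_regular f.1)
  comp_id f := Subtype.ext (regular_comp f.1)
  assoc f g h := Subtype.ext (comp_assoc h.1 g.1 f.1).symm

instance : Preadditive P.Obj where
  homGroup H G := inferInstanceAs (AddCommGroup (homSubgroup H G))
  add_comp _ _ _ f f' g := Subtype.ext (map_add (comp g.1) f.1 f'.1)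
  comp_add _ _ _ f g g' := Subtype.ext (DFunLike.congr_fun (map_add comp g.1 g'.1) f.1)

/-- The morphism `[U] : H ⟶ G` given by a `(G, H)`-biset `U` with point stabilizers in
`𝒮(G, H)`. -/
def ofBiset {G H : P.Obj} (U : GSet (G × H))
    (hU : ∀ u : U, MulAction.stabilizer (G × H) u ∈ P.S G.grp H.grp) : H ⟶ G :=
  ⟨cls U, cls_mem_hom U hU⟩

/-- The morphism `[(G × H) / D] : H ⟶ G` for `D ∈ 𝒮(G, H)`. -/
def ofSubgroup {G H : P.Obj} (D : Subgroup (G × H)) (hD : D ∈ P.S G.grp H.grp) : H ⟶ G :=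
  ofBiset (GSet.coset D) (stabilizer_coset_mem hD)

end BisetSystem

open BisetSystem

/-- A biset functor on `𝒟` over `R`: an additive functor from `𝒟` to `R`-modules. These form the
category `ℱ_{𝒟, R}`, with natural transformations as morphisms. -/
abbrev BisetFunctor {α : Type u} (P : BisetSystem α) (R : Type w) [CommRing R] :=
  P.Obj ⥤+ ModuleCat.{v} R

section Gamma

variable {α : Type u} {P : BisetSystem α}

/-- The set `Σ_𝒢(G)` of subgroups of `G` that belong to `𝒢`. -/
@[ext]
structure Sg (G : P.Obj) where
  subgroup : Subgroup G
  mem : G.grp.sub subgroup ∈ P.mem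

/-- A subgroup of `G` belonging to `𝒢`, as an object of `𝒟`. -/
def Sg.toObj {G : P.Obj} (A : Sg G) : P.Obj := ⟨G.grp.sub A.subgroup, A.mem⟩

/-- A finite `G`-set `X` with `G_x ∈ 𝒢` for all `x ∈ X`. -/
structure AdmSet (G : P.Obj) where
  X : GSet G
  mem : ∀ x : X, G.grp.sub (MulAction.stabilizer G x) ∈ P.mem

/-- The stabilizer `G_x`. -/
def AdmSet.stab {G : P.Obj} (X : AdmSet G) (x : X.X) : Sg G :=
  ⟨MulAction.stabilizer G x, X.mem x⟩

/-- Disjoint union. -/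
def AdmSet.sum {G : P.Obj} (X Y : AdmSet G) : AdmSet G where
  X := X.X.sum Y.X
  mem := by
    rintro (x | y)
    · have : MulAction.stabilizer G (show X.X.sum Y.X from Sum.inl x) =
          MulAction.stabilizer G x := by
        ext g
        exact Sum.inl_injective.eq_iff (a := g • x)
      rw [this]
      exact X.mem x
    · have : MulAction.stabilizer G (show X.X.sum Y.X from Sum.inr y) =
          MulAction.stabilizer G y := by
        ext g
        exact Sum.inr_injective.eq_iff (a := g • y)
      rw [this]
      exact Y.mem y

theorem AdmSet.stab_inl {G : P.Obj} (X Y : AdmSet G) (x : X.X) :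
    X.stab x = (X.sum Y).stab (Sum.inl x) := by
  ext g
  exact (Sum.inl_injective.eq_iff (a := g • x)).symm

theorem AdmSet.stab_inr {G : P.Obj} (X Y : AdmSet G) (y : Y.X) :
    Y.stab y = (X.sum Y).stab (Sum.inr y) := by
  ext g
  exact (Sum.inr_injective.eq_iff (a := g • y)).symm

theorem AdmSet.stab_conj {G : P.Obj} (X : AdmSet G) (g : G) (x : X.X) :
    (X.stab x).subgroup = conjSub g (X.stab (g⁻¹ • x)).subgroup := by
  ext h
  rw [mem_conjSub]
  change h • x = x ↔ (g⁻¹ * h * g) • g⁻¹ • x = g⁻¹ • x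
  rw [smul_smul, mul_assoc, mul_assoc, mul_inv_cancel, mul_one, mul_smul]
  exact (MulAction.injective g⁻¹).eq_iff.symm

/-- The `G`-set `G / A` for `A ∈ Σ_𝒢(G)`. -/
def cosetAdm [P.RestrictionClosed] {G : P.Obj} (A : Sg G) : AdmSet G where
  X := GSet.coset A.subgroup
  mem := by
    intro x
    obtain ⟨a, rfl⟩ := QuotientGroup.mk_surjective x
    have h := stabilizer_coset A.subgroup a
    exact h ▸ (conj_restr G.grp G.mem a A.subgroup A.mem).1

/-- The stabilizer of the trivial coset of `G / A` is `A`. -/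
theorem cosetAdm_stab [P.RestrictionClosed] {G : P.Obj} (A : Sg G) :
    (cosetAdm A).stab ((1 : G) : G ⧸ A.subgroup) = A := by
  ext g
  have h := stabilizer_coset A.subgroup (1 : G)
  exact (SetLike.ext_iff.1 h g).trans (by simp [mem_conjSub])

variable [hP : P.RestrictionClosed]

/-- The conjugate `ᵍA ∈ Σ_𝒢(G)` of `A ∈ Σ_𝒢(G)`. -/
def Sg.conj {G : P.Obj} (g : G) (A : Sg G) : Sg G :=
  ⟨conjSub g A.subgroup, (conj_restr G.grp G.mem g A.subgroup A.mem).1⟩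

/-- For `A = ᵍB`, the morphism `iso_{c_g} : B ⟶ A` of `𝒟` given by the conjugation isomorphism
`c_g : B → A`, `b ↦ g b g⁻¹`, that is, the class of `(A × B) / {(g b g⁻¹, b) | b ∈ B}`. -/
def conjHom {G : P.Obj} (g : G) (A B : Sg G) (h : A.subgroup = conjSub g B.subgroup) :
    B.toObj ⟶ A.toObj :=
  ofSubgroup (G := A.toObj) (H := B.toObj) (restr (twDiag g) A.subgroup B.subgroup) (by
    obtain ⟨A, hA⟩ := A
    obtain rfl : A = _ := h
    exact (conj_restr G.grp G.mem g B.subgroup B.mem).2)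

variable {R : Type w} [CommRing R]

/-- The action of `g ∈ G` on sections of `F` over `X`: `(g · s)(x) = ᵍ(s(g⁻¹ x))`, where `ᵍ` is
the map `F(iso_{c_g}) : F(G_{g⁻¹ x}) → F(G_x)`. -/
def sectionAct (F : BisetFunctor.{u, v} P R) {G : P.Obj} (X : AdmSet G) (g : G)
    (s : ∀ x : X.X, F.obj.obj (X.stab x).toObj) : ∀ x : X.X, F.obj.obj (X.stab x).toObj :=
  fun x => F.obj.map (conjHom g (X.stab x) (X.stab (g⁻¹ • x)) (X.stab_conj g x)) (s (g⁻¹ • x))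

/-- The `R`-module of `G`-equivariant sections of `F` over `X`. -/
def EqSec (F : BisetFunctor.{u, v} P R) {G : P.Obj} (X : AdmSet G) :
    Submodule R (∀ x : X.X, F.obj.obj (X.stab x).toObj) where
  carrier := {s | ∀ g : G, sectionAct F X g s = s}
  add_mem' := by
    intro s t hs ht g
    funext x
    have h1 := congrFun (hs g) x
    have h2 := congrFun (ht g) x
    simp only [sectionAct, Pi.add_apply, map_add] at h1 h2 ⊢
    rw [h1, h2]
  zero_mem' := by
    intro g
    funext x
    simp only [sectionAct, Pi.zero_apply, map_zero]
  smul_mem' := by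
    intro r s hs g
    funext x
    have h1 := congrFun (hs g) x
    simp only [sectionAct, Pi.smul_apply, map_smul] at h1 ⊢
    rw [h1]

/-- For equal subgroups `A = B` of `G` the identification of `F(A)` with `F(B)`. -/
def transp (F : BisetFunctor.{u, v} P R) {G : P.Obj} {A B : Sg G} (h : A = B) :
    F.obj.obj A.toObj ⟶ F.obj.obj B.toObj :=
  F.obj.map (eqToHom (congrArg Sg.toObj h))

theorem transp_rfl (F : BisetFunctor.{u, v} P R) {G : P.Obj} {A : Sg G} (h : A = A)
    (m : F.obj.obj A.toObj) : transp F h m = m := by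
  simp [transp]

theorem transp_transp (F : BisetFunctor.{u, v} P R) {G : P.Obj} {A B C : Sg G} (h : A = B)
    (h' : B = C) (m : F.obj.obj A.toObj) : transp F h' (transp F h m) = transp F (h.trans h') m := by
  subst h h'
  simp [transp]

theorem conjHom_transp (F : BisetFunctor.{u, v} P R) {G : P.Obj} {g : G} {A A' B B' : Sg G}
    (hA : A = A') (hB : B = B') (h : A.subgroup = conjSub g B.subgroup)
    (h' : A'.subgroup = conjSub g B'.subgroup) (m : F.obj.obj B.toObj) :
    F.obj.map (conjHom g A' B' h') (transp F hB m) =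
      transp F hA (F.obj.map (conjHom g A B h) m) := by
  subst hA hB
  simp [transp]

/-- The objects `(X, s)` of the category `Γ_F(G)`. -/
structure Gam (F : BisetFunctor.{u, v} P R) (G : P.Obj) where
  X : AdmSet G
  s : EqSec F X

namespace Gam

variable {F : BisetFunctor.{u, v} P R} {G : P.Obj}

/-- A morphism `(X, s) → (Y, t)` in `Γ_F(G)`: a map `f` of `G`-sets with `G_{f(x)} = G_x` and
`t(f(x)) = s(x)` for all `x ∈ X`. -/
@[ext]
structure Hom (a b : Gam F G) where
  toFun : a.X.X → b.X.X
  map_smul : ∀ (g : G) (x : a.X.X), toFun (g • x) = g • toFun x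
  stab_eq : ∀ x, a.X.stab x = b.X.stab (toFun x)
  section_eq : ∀ x, b.s.1 (toFun x) = transp F (stab_eq x) (a.s.1 x)

instance : Category (Gam F G) where
  Hom := Hom
  id a := ⟨id, fun _ _ => rfl, fun _ => rfl, fun _ => (transp_rfl F rfl _).symm⟩
  comp f f' := ⟨f'.toFun ∘ f.toFun,
    fun g x => by simp only [Function.comp, f.map_smul, f'.map_smul],
    fun x => (f.stab_eq x).trans (f'.stab_eq _),
    fun x => by simp only [Function.comp, f'.section_eq, f.section_eq, transp_transp]⟩

/-- The coproduct `(X, s) ⨿ (Y, t) = (X ⨿ Y, s ⨿ t)`. -/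
def coprod (a b : Gam F G) : Gam F G where
  X := a.X.sum b.X
  s := ⟨Sum.rec (fun x => transp F (a.X.stab_inl b.X x) (a.s.1 x))
      (fun y => transp F (a.X.stab_inr b.X y) (b.s.1 y)), by
    intro g
    funext x
    rcases x with x | y
    · have h := congrFun (a.s.2 g) x
      refine (conjHom_transp F (a.X.stab_inl b.X x) (a.X.stab_inl b.X (g⁻¹ • x))
        (a.X.stab_conj g x) ((a.X.sum b.X).stab_conj g (Sum.inl x)) _).trans ?_
      exact congrArg _ h
    · have h := congrFun (b.s.2 g) y
      refine (conjHom_transp F (a.X.stab_inr b.X y) (a.X.stab_inr b.X (g⁻¹ • y))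
        (b.X.stab_conj g y) ((a.X.sum b.X).stab_conj g (Sum.inr y)) _).trans ?_
      exact congrArg _ h⟩

/-- `r (X, s) = (X, r s)`. -/
def smul (r : R) (a : Gam F G) : Gam F G := ⟨a.X, r • a.s⟩

/-- The effect of `smul r` on morphisms. -/
def smulMap (r : R) {a b : Gam F G} (f : a ⟶ b) : smul r a ⟶ smul r b where
  toFun := f.toFun
  map_smul := f.map_smul
  stab_eq := f.stab_eq
  section_eq x := by
    exact (congrArg (r • ·) (f.section_eq x)).trans
      (map_smul (transp F (f.stab_eq x)).hom r (a.s.1 x)).symm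

end Gam

/-- The set of isomorphism classes `{X, s}` of objects of `Γ_F(G)`. -/
abbrev GamIso (F : BisetFunctor.{u, v} P R) (G : P.Obj) := Quotient (isIsomorphicSetoid (Gam F G))

/-- The isomorphism class `{X, s}`. -/
def GamIso.mk {F : BisetFunctor.{u, v} P R} {G : P.Obj} (a : Gam F G) : GamIso F G :=
  Quotient.mk _ a

/-- The element `{X, s}` of the free abelian group on the isomorphism classes. -/
def gamOf {F : BisetFunctor.{u, v} P R} {G : P.Obj} (a : Gam F G) :
    FreeAbelianGroup (GamIso F G) :=
  FreeAbelianGroup.of (GamIso.mk a)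

/-- The elements `{X ⨿ Y, s ⨿ t} - {X, s} - {Y, t}` and `{X, s + u} - {X, s} - {X, u}`. -/
inductive PlusRel (F : BisetFunctor.{u, v} P R) (G : P.Obj) :
    FreeAbelianGroup (GamIso F G) → Prop
  | coprod (a b : Gam F G) : PlusRel F G (gamOf (a.coprod b) - gamOf a - gamOf b)
  | add (X : AdmSet G) (s t : EqSec F X) :
      PlusRel F G (gamOf ⟨X, s + t⟩ - gamOf ⟨X, s⟩ - gamOf ⟨X, t⟩)

/-- The subgroup generated by these elements. -/
def plusRel (F : BisetFunctor.{u, v} P R) (G : P.Obj) :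
    AddSubgroup (FreeAbelianGroup (GamIso F G)) :=
  AddSubgroup.closure {x | PlusRel F G x}

/-- The abelian group `F₊(G)`. -/
def FPlus (F : BisetFunctor.{u, v} P R) (G : P.Obj) :=
  FreeAbelianGroup (GamIso F G) ⧸ plusRel F G

namespace FPlus

variable {F : BisetFunctor.{u, v} P R} {G : P.Obj}

instance : AddCommGroup (FPlus F G) :=
  inferInstanceAs (AddCommGroup (FreeAbelianGroup (GamIso F G) ⧸ plusRel F G))

/-- The class `[X, s]` in `F₊(G)`. -/
def mk (a : Gam F G) : FPlus F G := QuotientAddGroup.mk' (plusRel F G) (gamOf a)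

theorem mk_coprod (a b : Gam F G) : mk (a.coprod b) = mk a + mk b := by
  have h := (QuotientAddGroup.eq_zero_iff _).2
    (AddSubgroup.subset_closure (PlusRel.coprod a b) : _ ∈ plusRel F G)
  rw [sub_sub] at h
  exact sub_eq_zero.1 h

theorem mk_add (X : AdmSet G) (s t : EqSec F X) : mk ⟨X, s + t⟩ = mk ⟨X, s⟩ + mk ⟨X, t⟩ := by
  have h := (QuotientAddGroup.eq_zero_iff _).2
    (AddSubgroup.subset_closure (PlusRel.add X s t) : _ ∈ plusRel F G)
  rw [sub_sub] at h
  exact sub_eq_zero.1 h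

theorem hom_ext {B : Type*} [AddCommGroup B] {f g : FPlus F G →+ B}
    (h : ∀ a, f (mk a) = g (mk a)) : f = g := by
  apply QuotientAddGroup.addMonoidHom_ext
  apply FreeAbelianGroup.lift_ext
  rintro ⟨a⟩
  exact h a

/-- Multiplication by `r` on isomorphism classes: `r {X, s} = {X, r s}`. -/
def smulIso (r : R) : GamIso F G → GamIso F G :=
  Quotient.map (Gam.smul r) (by
    rintro a b ⟨e⟩
    refine ⟨⟨Gam.smulMap r e.hom, Gam.smulMap r e.inv, ?_, ?_⟩⟩
    · have h := congrArg Gam.Hom.toFun e.hom_inv_id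
      exact Gam.Hom.ext h
    · have h := congrArg Gam.Hom.toFun e.inv_hom_id
      exact Gam.Hom.ext h)

/-- Multiplication by `r` on `F₊(G)`: `r [X, s] = [X, r s]`. -/
def smulHom (r : R) : FPlus F G →+ FPlus F G :=
  QuotientAddGroup.map (plusRel F G) (plusRel F G) (FreeAbelianGroup.map (smulIso r)) (by
    refine (AddSubgroup.closure_le _).2 ?_
    rintro _ (⟨a, b⟩ | ⟨X, s, t⟩)
    · apply AddSubgroup.subset_closure
      have h : Gam.smul r (a.coprod b) = (Gam.smul r a).coprod (Gam.smul r b) := by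
        refine congrArg (Gam.mk _) (Subtype.ext ?_)
        funext x
        rcases x with x | y
        · exact (map_smul (transp F (a.X.stab_inl b.X x)).hom r _).symm
        · exact (map_smul (transp F (a.X.stab_inr b.X y)).hom r _).symm
      have := PlusRel.coprod (Gam.smul r a) (Gam.smul r b)
      rw [← h] at this
      simp only [gamOf, map_sub, FreeAbelianGroup.map_of_apply, Set.mem_ofPred_eq]
      exact this
    · apply AddSubgroup.subset_closure
      have := PlusRel.add X (r • s) (r • t)
      rw [← smul_add] at this
      simp only [gamOf, map_sub, FreeAbelianGroup.map_of_apply, Set.mem_ofPred_eq]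
      exact this)

theorem smulHom_mk (r : R) (a : Gam F G) : smulHom r (mk a) = mk (a.smul r) := rfl

/-- The `R`-module structure of `F₊(G)`, with `r [X, s] = [X, r s]`. -/
instance : Module R (FPlus F G) where
  smul r x := smulHom r x
  one_smul x := by
    have : (smulHom 1 : FPlus F G →+ FPlus F G) = AddMonoidHom.id _ := by
      apply hom_ext
      rintro ⟨X, s⟩
      simp [smulHom_mk, Gam.smul]
    exact DFunLike.congr_fun this x
  mul_smul r r' x := by
    have : (smulHom (r * r') : FPlus F G →+ FPlus F G) = (smulHom r).comp (smulHom r') := by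
      apply hom_ext
      rintro ⟨X, s⟩
      simp [smulHom_mk, Gam.smul, mul_smul]
    exact DFunLike.congr_fun this x
  smul_zero r := map_zero (smulHom r)
  smul_add r := map_add (smulHom r)
  add_smul r r' x := by
    have : (smulHom (r + r') : FPlus F G →+ FPlus F G) = smulHom r + smulHom r' := by
      apply hom_ext
      rintro ⟨X, s⟩
      simp [smulHom_mk, Gam.smul, add_smul, mk_add]
    exact DFunLike.congr_fun this x
  zero_smul x := by
    have : (smulHom 0 : FPlus F G →+ FPlus F G) = 0 := by
      apply hom_ext
      rintro ⟨X, s⟩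
      have h := mk_add X (0 : EqSec F X) 0
      rw [add_zero, left_eq_add] at h
      simp [smulHom_mk, Gam.smul, h]
    exact DFunLike.congr_fun this x

theorem smul_mk (r : R) (a : Gam F G) : r • mk a = mk (a.smul r) := rfl

end FPlus

/-! ## The direct sum of the `F(A)` -/

/-- The direct sum of the `R`-modules `F(A)` over `A ∈ Σ_𝒢(G)`. -/
abbrev SumSg (F : BisetFunctor.{u, v} P R) (G : P.Obj) :=
  DirectSum (Sg G) (fun A => F.obj.obj A.toObj)

open Classical in
/-- The inclusion of the summand `F(A)`. -/
def SumSg.incl (F : BisetFunctor.{u, v} P R) (G : P.Obj) (A : Sg G) :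
    F.obj.obj A.toObj →ₗ[R] SumSg F G :=
  DirectSum.lof R (Sg G) (fun A => F.obj.obj A.toObj) A

/-! ## The functors `Γ_F(U)` on objects -/

/-- The `H`-orbit relation on `U × X`, for `h (u, x) = (u h⁻¹, h x)`. -/
def actSetoid {G H : Type u} [Group G] [Group H] (U : GSet (G × H)) (X : GSet H) :
    Setoid (U × X) where
  r a b := ∃ h : H, ((1, h) : G × H) • a.1 = b.1 ∧ h • a.2 = b.2
  iseqv :=
    { refl := fun a => ⟨1, one_smul (G × H) _, one_smul H _⟩
      symm := by
        rintro ⟨u, v⟩ ⟨_, _⟩ ⟨h, rfl, rfl⟩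
        exact ⟨h⁻¹, by simp [smul_smul, one_one_smul], by simp⟩
      trans := by
        rintro ⟨u, v⟩ ⟨_, _⟩ ⟨_, _⟩ ⟨h, rfl, rfl⟩ ⟨k, rfl, rfl⟩
        exact ⟨k * h, by simp [smul_smul], by simp [smul_smul]⟩ }

/-- The `G`-set `U ×_H X`, for a `(G, H)`-biset `U` and an `H`-set `X`. -/
def actSet {G H : Type u} [Group G] [Group H] (U : GSet (G × H)) (X : GSet H) : GSet G where
  carrier := Quotient (actSetoid U X)
  act :=
    { smul := fun g => Quotient.map (fun a => (((g, 1) : G × H) • a.1, a.2)) (by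
        rintro ⟨u, v⟩ ⟨_, _⟩ ⟨h, rfl, rfl⟩
        exact ⟨h, by simp [smul_smul], rfl⟩)
      one_smul := by
        rintro ⟨u, v⟩
        exact congrArg (Quotient.mk _) (Prod.ext (one_smul (G × H) u) rfl)
      mul_smul := by
        rintro a b ⟨u, v⟩
        exact congrArg (Quotient.mk _) (Prod.ext (by simp [smul_smul]) rfl) }

/-- The element `[u, x]` of `U ×_H X`. -/
def actSet.mk {G H : Type u} [Group G] [Group H] {U : GSet (G × H)} {X : GSet H} (u : U) (x : X) :
    actSet U X :=
  Quotient.mk (actSetoid U X) (u, x)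

/-- `G_{[u, x]} = (G × H)_u * H_x`. -/
theorem actSet.stabilizer_mk {G H : Type u} [Group G] [Group H] {U : GSet (G × H)} {X : GSet H}
    (u : U) (x : X) : MulAction.stabilizer G (actSet.mk u x) =
      starSub (MulAction.stabilizer (G × H) u) (MulAction.stabilizer H x) := by
  ext g
  rw [MulAction.mem_stabilizer_iff, mem_starSub]
  change Quotient.mk (actSetoid U X) (((g, 1) : G × H) • u, x) =
    Quotient.mk (actSetoid U X) (u, x) ↔ _
  rw [Quotient.eq]
  change (∃ h : H, ((1, h) : G × H) • ((g, 1) : G × H) • u = u ∧ h • x = x) ↔ _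
  simp only [smul_smul, MulAction.mem_stabilizer_iff, Prod.mk_mul_mk, one_mul, mul_one]
  exact exists_congr fun h => and_comm

variable {G H : P.Obj} (U : GSet (G × H))
  (hU : ∀ u : U, MulAction.stabilizer (G × H) u ∈ P.SPlus G.grp H.grp)

/-- `U ×_H X` for a `(G, H)`-biset `U` with point stabilizers in `𝒮₊(G, H)` and an `H`-set `X`
with point stabilizers in `𝒢`. -/
def actAdm (X : AdmSet H) : AdmSet G where
  X := actSet U X.X
  mem := by
    rintro ⟨u, x⟩
    have h := actSet.stabilizer_mk u x
    exact h ▸ (SPlus_restr H.mem (hU u) _ (X.mem x)).1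

theorem restr_mem {D : Subgroup (G × H)} (hD : D ∈ P.SPlus G.grp H.grp) (A : Sg G) (B : Sg H)
    (h : A.subgroup = starSub D B.subgroup) :
    restr D A.subgroup B.subgroup ∈ P.S A.toObj.grp B.toObj.grp := by
  obtain ⟨A, hA⟩ := A
  obtain rfl : A = _ := h
  exact (SPlus_restr H.mem hD _ B.mem).2

/-- The morphism `H_x ⟶ G_{[u, x]}` of `𝒟` given by the class of
`(G_{[u, x]} × H_x) / (G × H_x)_u`. -/
def actHom (X : AdmSet H) (u : U) (x : X.X) :
    (X.stab x).toObj ⟶ ((actAdm U hU X).stab (actSet.mk u x)).toObj :=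
  ofSubgroup (G := ((actAdm U hU X).stab (actSet.mk u x)).toObj) (H := (X.stab x).toObj)
    (restr (MulAction.stabilizer (G × H) u) ((actAdm U hU X).stab (actSet.mk u x)).subgroup
      (X.stab x).subgroup)
    (restr_mem (hU u) _ (X.stab x) (actSet.stabilizer_mk u x))

end Gamma

/-- An object of `𝒟`, as an object of `𝒟₊` (both categories have the groups in `𝒢` as objects). -/
def BisetSystem.Obj.toPlus {α : Type u} {P : BisetSystem α} [P.RestrictionClosed] (G : P.Obj) :
    P.plus.Obj := ⟨G.grp, G.mem⟩

/-- The morphism `[U] : H ⟶ G` of `𝒟₊` given by a `(G, H)`-biset `U` with point stabilizers in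
`𝒮₊(G, H)`. -/
def plusHom {α : Type u} {P : BisetSystem α} [P.RestrictionClosed] {G H : P.Obj}
    (U : GSet (G × H))
    (hU : ∀ u : U, MulAction.stabilizer (G × H) u ∈ P.SPlus G.grp H.grp) :
    H.toPlus ⟶ G.toPlus :=
  ofBiset (P := P.plus) (G := G.toPlus) (H := H.toPlus) U hU

end BisetPlus

end

noncomputable section

namespace BisetPlus

open BisetSystem

/-! ## Composition of transitive bisets -/

/-! Conjugations `a ↦ ᵍa`, identifications of `F(A)` with `F(B)` for `A = B`, and the maps `F(H_x) →
F(G_{[u, x]})` that define `U(s)` all have one shape: `F` applied to the class of `(A × B) / (D ∩ (A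
× B))`, where `D` is a twisted diagonal, the diagonal, or a point stabilizer. In every composite
that occurs, the right factor projects onto the whole middle group; for `U(s)` this is the equality
`G_{[u, x]} = (G × H)_u * H_x`. The Mackey formula then has a single term (`comp_cls_coset`), so the
composite belongs to the `*`-product. By `restrHom_comp`, independence of representatives,
equivariance of `U(s)` and compatibility with `U ×_H V` all become membership statements about group
elements.

The canonical isomorphisms of `U ×_H X` (distributivity over disjoint unions, unit, associativity)
respect the sections, so `U` induces a linear map `actMap` on `F₊` that is additive in `U` and turns
`U ×_H V` into a composite. A morphism of `𝒟₊` is an element of a subgroup of `B(G, H)`. Instead of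
a presentation of that subgroup, the action is defined on all of `B(G, H)` by first discarding the
points whose stabilizers are not in `𝒮₊(G, H)`; this is additive, and changes nothing for the bisets
that matter.

For the cofixed points, `a ↦ [A, a]_G` is constant on conjugates because right translation
identifies `G/A` with `G/ᵍA`. It is surjective because each `(X, s)` is a disjoint union of orbits
and a section over `G/A` is determined by its value at the trivial coset (`mk_mem_range`). It is
injective because summing the classes of `s(x)` over orbit representatives gives a left inverse
(`toCofixed`). Surjectivity also shows that `F₊(G)` is small, so that `F₊` takes values in the same
category of modules as `F`. -/

/-- A transitive `A`-set is isomorphic to the cosets of a point stabilizer. -/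
def GSet.isoCoset {A : Type u} [Group A] [Finite A] (X : GSet A) (x : X)
    (h : ∀ y : X, ∃ a : A, a • x = y) : GSet.Iso (GSet.coset (MulAction.stabilizer A x)) X :=
  GSet.isoOfBijective (MulAction.ofQuotientStabilizer A x)
    ⟨MulAction.injective_ofQuotientStabilizer A x, fun y => by
      obtain ⟨a, rfl⟩ := h y
      exact ⟨(a : A ⧸ MulAction.stabilizer A x), rfl⟩⟩
    (MulAction.ofQuotientStabilizer_smul A x)

/-- To recognise `[A/D]` it suffices to exhibit a point with stabilizer `D` in a transitive set; the
Mackey formula and the identities for identity morphisms are obtained in this way. -/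
theorem cls_coset_eq {A : Type u} [Group A] [Finite A] {X : GSet A} {D : Subgroup A} (x : X)
    (h : ∀ y : X, ∃ a : A, a • x = y) (hD : MulAction.stabilizer A x = D) :
    cls (GSet.coset D) = cls X := by
  subst hD
  exact cls_eq (X.isoCoset x h)

/-- The coset `aD`, as an element of the `A`-set `A / D`. -/
def GSet.cosetMk {A : Type u} [Group A] [Finite A] (D : Subgroup A) (a : A) : GSet.coset D :=
  (a : A ⧸ D)

theorem stabilizer_cosetMk_one {A : Type u} [Group A] [Finite A] (D : Subgroup A) :
    MulAction.stabilizer A (GSet.cosetMk D 1) = D := by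
  refine (stabilizer_coset D 1).trans ?_
  ext x
  simp [mem_conjSub]

/-- The Mackey formula, in the case where the right factor has full first projection. -/
theorem comp_cls_coset {G H K : Type u} [Group G] [Group H] [Group K] [Finite G] [Finite H]
    [Finite K] (D : Subgroup (G × H)) (E : Subgroup (H × K)) (hE : ∀ h : H, ∃ k, (h, k) ∈ E) :
    comp (cls (GSet.coset D)) (cls (GSet.coset E)) = cls (GSet.coset (star D E)) := by
  rw [comp_cls]
  symm
  refine cls_coset_eq (tens.mk (GSet.cosetMk D 1) (GSet.cosetMk E 1)) ?_ ?_
  · intro y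
    induction y using tens.ind with
    | _ p q =>
    obtain ⟨⟨g, h⟩, rfl⟩ := QuotientGroup.mk_surjective p
    obtain ⟨⟨h', k⟩, rfl⟩ := QuotientGroup.mk_surjective q
    -- Since `(h', k)E = (h, k k')E`, both representatives may be given the same `H`-component `h`,
    -- which the tensor relation absorbs. This is where full projection of `E` makes the tensor
    -- product transitive.
    obtain ⟨k', hk'⟩ := hE (h'⁻¹ * h)
    refine ⟨(g, k * k'), tens.mk_eq.2 ⟨h, ?_, ?_⟩⟩
    · refine congrArg (QuotientGroup.mk (s := D)) ?_
      simp
    · refine (QuotientGroup.eq (s := E)).2 ?_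
      simpa using inv_mem hk'
  · rw [tens.stabilizer_mk, stabilizer_cosetMk_one, stabilizer_cosetMk_one]

/-! ### Morphisms given by restricted subgroups -/

section Restricted

variable {α : Type u} {P : BisetSystem α}

/-- The morphism of `𝒟` given by the intersection of `D ≤ G × H` with `A × B`. -/
def restrHom {G H : P.Obj} (D : Subgroup (G × H)) (A : Sg G) (B : Sg H)
    (hD : restr D A.subgroup B.subgroup ∈ P.S A.toObj.grp B.toObj.grp) : B.toObj ⟶ A.toObj :=
  ofSubgroup (G := A.toObj) (H := B.toObj) (restr D A.subgroup B.subgroup) hD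

theorem restr_mem_congr {G H : P.Obj} {D : Subgroup (G × H)} {A A' : Sg G} {B B' : Sg H}
    (hA : A = A') (hB : B = B')
    (h : restr D A.subgroup B.subgroup ∈ P.S A.toObj.grp B.toObj.grp) :
    restr D A'.subgroup B'.subgroup ∈ P.S A'.toObj.grp B'.toObj.grp := by
  subst hA hB
  exact h

/-- By `h₁` the restricted `E` has first projection `B`, so the Mackey formula has one term; `h₂`
says that this term is the restriction of `D'`. Later identities between morphisms are reduced to
these two elementwise conditions. -/
theorem restrHom_comp {G H K : P.Obj} {D : Subgroup (G × H)} {E : Subgroup (H × K)}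
    {D' : Subgroup (G × K)} {A : Sg G} {B : Sg H} {C : Sg K}
    (hD : restr D A.subgroup B.subgroup ∈ P.S A.toObj.grp B.toObj.grp)
    (hE : restr E B.subgroup C.subgroup ∈ P.S B.toObj.grp C.toObj.grp)
    (hD' : restr D' A.subgroup C.subgroup ∈ P.S A.toObj.grp C.toObj.grp)
    (h₁ : ∀ b ∈ B.subgroup, ∃ c ∈ C.subgroup, (b, c) ∈ E)
    (h₂ : ∀ a ∈ A.subgroup, ∀ c ∈ C.subgroup,
      ((a, c) ∈ D' ↔ ∃ b ∈ B.subgroup, (a, b) ∈ D ∧ (b, c) ∈ E)) :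
    restrHom E B C hE ≫ restrHom D A B hD = restrHom D' A C hD' := by
  refine Subtype.ext ?_
  refine (comp_cls_coset (G := A.toObj) (H := B.toObj) (K := C.toObj)
    (restr D A.subgroup B.subgroup) (restr E B.subgroup C.subgroup) ?_).trans ?_
  · intro b
    obtain ⟨c, hc, hbc⟩ := h₁ _ (H.grp.incl_mem _ b)
    obtain ⟨c, rfl⟩ := K.grp.exists_incl _ hc
    exact ⟨c, hbc⟩
  · refine congrArg (fun D => cls (GSet.coset D)) ?_
    ext ⟨a, c⟩
    refine Iff.trans ?_ (h₂ _ (G.grp.incl_mem _ a) _ (K.grp.incl_mem _ c)).symm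
    constructor
    · rintro ⟨b, hb⟩
      exact ⟨_, H.grp.incl_mem _ b, hb⟩
    · rintro ⟨b, hb, hb'⟩
      obtain ⟨b, rfl⟩ := H.grp.exists_incl _ hb
      exact ⟨b, hb'⟩

theorem mem_restr_diag {G : FGrp α} {A : Subgroup G} {x : G.sub A × G.sub A} :
    x ∈ restr (diag G) A A ↔ x.1 = x.2 :=
  Iff.trans (Iff.trans mem_restr mem_diag) (G.incl_injective A).eq_iff

theorem diag_restr_mem {G : P.Obj} {A B : Sg G} (h : A = B) :
    restr (diag G) B.subgroup A.subgroup ∈ P.S B.toObj.grp A.toObj.grp := by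
  subst h
  refine S_congr rfl rfl ?_ (P.diag_mem _ A.mem)
  rintro a b a' b' ha hb
  obtain rfl := Subtype.ext ha
  obtain rfl := Subtype.ext hb
  exact mem_diag.trans mem_restr_diag.symm

/-- Brings transports into the common shape, with the diagonal as subgroup, so that `restrHom_comp`
also applies to them. The point `1` of the regular biset has the diagonal as its stabilizer. -/
theorem eqToHom_eq_restrHom {G : P.Obj} {A B : Sg G} (h : A = B) :
    eqToHom (congrArg Sg.toObj h) = restrHom (diag G) B A (diag_restr_mem h) := by
  subst h
  refine Subtype.ext (cls_coset_eq (X := regular A.toObj) (1 : A.toObj) ?_ ?_).symm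
  · intro y
    have h (z : A.toObj) : z * 1 * 1⁻¹ = z := by simp
    exact ⟨(y, 1), h y⟩
  · ext ⟨a, b⟩
    refine Iff.trans ?_ mem_restr_diag.symm
    change a * 1 * b⁻¹ = 1 ↔ _
    rw [mul_one, mul_inv_eq_one]
    exact Iff.rfl

section

variable {R : Type w} [CommRing R] (F : BisetFunctor.{u, v} P R)

theorem map_restrHom_comp {G H K : P.Obj} {D : Subgroup (G × H)} {E : Subgroup (H × K)}
    {D' : Subgroup (G × K)} {A : Sg G} {B : Sg H} {C : Sg K}
    {hD : restr D A.subgroup B.subgroup ∈ P.S A.toObj.grp B.toObj.grp}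
    {hE : restr E B.subgroup C.subgroup ∈ P.S B.toObj.grp C.toObj.grp}
    (hD' : restr D' A.subgroup C.subgroup ∈ P.S A.toObj.grp C.toObj.grp)
    (h₁ : ∀ b ∈ B.subgroup, ∃ c ∈ C.subgroup, (b, c) ∈ E)
    (h₂ : ∀ a ∈ A.subgroup, ∀ c ∈ C.subgroup,
      ((a, c) ∈ D' ↔ ∃ b ∈ B.subgroup, (a, b) ∈ D ∧ (b, c) ∈ E)) (m : F.obj.obj C.toObj) :
    F.obj.map (restrHom D A B hD) (F.obj.map (restrHom E B C hE) m) =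
      F.obj.map (restrHom D' A C hD') m := by
  rw [← restrHom_comp hD hE hD' h₁ h₂, F.obj.map_comp]
  rfl

theorem transp_eq {G : P.Obj} {A B : Sg G} (h : A = B) (m : F.obj.obj A.toObj) :
    transp F h m = F.obj.map (restrHom (diag G) B A (diag_restr_mem h)) m := by
  rw [transp, eqToHom_eq_restrHom h]

/-- Absorbs a transport on the source side, and at the same time replaces `D` by any subgroup with
the same trace on `A × B`. `transp_map_restrHom` does this on the target side. -/
theorem map_restrHom_transp {G H : P.Obj} {D D' : Subgroup (G × H)} {A : Sg G} {B B' : Sg H}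
    (h : B' = B) {hD : restr D A.subgroup B.subgroup ∈ P.S A.toObj.grp B.toObj.grp}
    (hD' : restr D' A.subgroup B'.subgroup ∈ P.S A.toObj.grp B'.toObj.grp)
    (hDD' : ∀ a ∈ A.subgroup, ∀ b ∈ B.subgroup, ((a, b) ∈ D' ↔ (a, b) ∈ D))
    (m : F.obj.obj B'.toObj) :
    F.obj.map (restrHom D A B hD) (transp F h m) = F.obj.map (restrHom D' A B' hD') m := by
  subst h
  rw [transp_eq]
  refine map_restrHom_comp F hD' (fun b hb => ⟨b, hb, mem_diag.2 rfl⟩) (fun a ha b hb => ?_) m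
  rw [hDD' a ha b hb]
  constructor
  · exact fun h => ⟨b, hb, h, mem_diag.2 rfl⟩
  · rintro ⟨c, -, h, h'⟩
    obtain rfl : c = b := mem_diag.1 h'
    exact h

end

theorem AdmSet.stab_smul {G : P.Obj} (X : AdmSet G) {g : G} {x y : X.X} (h : g • x = y) :
    (X.stab y).subgroup = conjSub g (X.stab x).subgroup := by
  obtain rfl : x = g⁻¹ • y := by rw [← h, inv_smul_smul]
  exact X.stab_conj g y

variable [P.RestrictionClosed] {R : Type w} [CommRing R] (F : BisetFunctor.{u, v} P R)

theorem transp_map_restrHom {G H : P.Obj} {D D' : Subgroup (G × H)} {A A' : Sg G} {B : Sg H}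
    (h : A = A') {hD : restr D A.subgroup B.subgroup ∈ P.S A.toObj.grp B.toObj.grp}
    (hD' : restr D' A'.subgroup B.subgroup ∈ P.S A'.toObj.grp B.toObj.grp)
    (hDD' : ∀ a ∈ A.subgroup, ∀ b ∈ B.subgroup, ((a, b) ∈ D' ↔ (a, b) ∈ D))
    (m : F.obj.obj B.toObj) :
    transp F h (F.obj.map (restrHom D A B hD) m) = F.obj.map (restrHom D' A' B hD') m := by
  subst h
  rw [transp_rfl, ← map_restrHom_transp F rfl hD' hDD', transp_rfl]

theorem transp_map_app {F F' : BisetFunctor.{u, v} P R} (φ : F ⟶ F') {G : P.Obj} {A B : Sg G}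
    (h : A = B) (m : F.obj.obj A.toObj) :
    φ.hom.app B.toObj (transp F h m) = transp F' h (φ.hom.app A.toObj m) := by
  subst h
  rw [transp_rfl, transp_rfl]

/-- Equivariance in the form `ᵍ(s(x)) = s(gx)`, with `gx` replaced by a variable `y` so that no
inverse enters the type of the value. -/
theorem EqSec.map_conjHom {F : BisetFunctor.{u, v} P R} {G : P.Obj} {X : AdmSet G} (s : EqSec F X)
    (g : G) {x y : X.X} (h : g • x = y)
    (hxy : (X.stab y).subgroup = conjSub g (X.stab x).subgroup) :
    F.obj.map (conjHom g (X.stab y) (X.stab x) hxy) (s.1 x) = s.1 y := by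
  obtain rfl : x = g⁻¹ • y := by rw [← h, inv_smul_smul]
  exact congrFun (s.2 g) y

end Restricted

/-! ### The functors `Γ_F(U)` -/

section GammaFunctor

variable {α : Type u} {P : BisetSystem α}

theorem AdmSet.stab_eq_of_injective {G : P.Obj} {X Y : AdmSet G} {f : X.X → Y.X} (hf : Function.Injective f)
    (hs : ∀ (g : G) x, f (g • x) = g • f x) (x : X.X) : X.stab x = Y.stab (f x) := by
  ext g
  change g • x = x ↔ g • f x = f x
  rw [← hs, hf.eq_iff]

section

variable {G H : Type u} [Group G] [Group H]

theorem actSet.mk_eq {U : GSet (G × H)} {X : GSet H} {u u' : U} {x x' : X} :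
    actSet.mk u x = actSet.mk u' x' ↔ ∃ h : H, ((1, h) : G × H) • u = u' ∧ h • x = x' := by
  unfold actSet.mk
  exact Quotient.eq

theorem actSet.ind {U : GSet (G × H)} {X : GSet H} {p : actSet U X → Prop}
    (h : ∀ u x, p (actSet.mk u x)) (q : actSet U X) : p q := by
  induction q using Quotient.ind with
  | _ a => exact h a.1 a.2

theorem actSet.smul_mk {U : GSet (G × H)} {X : GSet H} (g : G) (u : U) (x : X) :
    g • actSet.mk u x = actSet.mk (((g, 1) : G × H) • u) x := rfl

theorem actSet.mem_stabilizer {U : GSet (G × H)} {X : GSet H} {u : U} {x : X} {q : actSet U X}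
    (hq : actSet.mk u x = q) {g : G} : g • q = q ↔ ∃ h : H, h • x = x ∧ ((g, h) : G × H) • u = u := by
  subst hq
  exact SetLike.ext_iff.1 (actSet.stabilizer_mk u x) g

end

variable [P.RestrictionClosed] {R : Type w} [CommRing R] {F : BisetFunctor.{u, v} P R} {G H K : P.Obj}

/-- Isomorphic objects of `Γ_F(G)` have the same class in `F₊(G)`. -/
theorem FPlus.mk_eq_of_iso {a b : Gam F G} (e : GSet.Iso a.X.X b.X.X)
    (he : ∀ x (h : a.X.stab x = b.X.stab (e.toEquiv x)),
      b.s.1 (e.toEquiv x) = transp F h (a.s.1 x)) : mk a = mk b := by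
  have hst := AdmSet.stab_eq_of_injective (X := a.X) (Y := b.X) e.toEquiv.injective e.map_smul
  let f : a ⟶ b := ⟨e.toEquiv, e.map_smul, hst, fun x => he x (hst x)⟩
  have hst' (y) : b.X.stab y = a.X.stab (e.toEquiv.symm y) := by
    rw [hst, Equiv.apply_symm_apply]
  let f' : b ⟶ a := ⟨e.toEquiv.symm, fun g y => e.toEquiv.injective (by simp [e.map_smul]), hst',
    fun y => by
      obtain ⟨x, rfl⟩ := e.toEquiv.surjective y
      rw [he x (hst x), transp_transp]
      generalize_proofs h
      -- The remaining transport joins the stabilizers of `x` and of `e.symm (e x)`; once the second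
      -- point is a variable, the two can be identified and the transport is trivial.
      generalize hx : e.toEquiv.symm (e.toEquiv x) = x' at h
      obtain rfl : x = x' := by rw [← hx, Equiv.symm_apply_apply]
      rw [transp_rfl]⟩
  refine congrArg (QuotientAddGroup.mk' (plusRel F G)) (congrArg FreeAbelianGroup.of
    (Quotient.sound ⟨⟨f, f', ?_, ?_⟩⟩))
  · exact Gam.Hom.ext (funext fun x => e.toEquiv.symm_apply_apply x)
  · exact Gam.Hom.ext (funext fun x => e.toEquiv.apply_symm_apply x)

variable (U : GSet (G × H)) (hU : ∀ u : U, MulAction.stabilizer (G × H) u ∈ P.SPlus G.grp H.grp)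

/-- The point `q` is a variable tied to `[u, x]` by an equation, so that values computed from
different representatives lie in the same module `F(G_q)`. -/
theorem act_restr_mem (X : AdmSet H) {u : U} {x : X.X} {q : (actAdm U hU X).X}
    (hq : actSet.mk u x = q) :
    restr (MulAction.stabilizer (G × H) u) ((actAdm U hU X).stab q).subgroup
      (X.stab x).subgroup ∈ P.S ((actAdm U hU X).stab q).toObj.grp (X.stab x).toObj.grp := by
  subst hq
  exact restr_mem (hU u) _ (X.stab x) (actSet.stabilizer_mk u x)

/-- The value of the section `U(s)` at `q = [u, x]`, computed from the representative `(u, x)`. -/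
def actVal {X : AdmSet H} (s : EqSec F X) (u : U) (x : X.X) (q : (actAdm U hU X).X)
    (hq : actSet.mk u x = q) : F.obj.obj ((actAdm U hU X).stab q).toObj :=
  F.obj.map (restrHom (MulAction.stabilizer (G × H) u) _ (X.stab x) (act_restr_mem U hU X hq))
    (s.1 x)

/-- Passing from `(u, x)` to `(u h⁻¹, h x)` conjugates the stabilizer of `u` by `(1, h)` and
replaces `s(x)` by `ʰ(s(x))`. The two changes cancel: the stabilizer of `u h⁻¹`, composed with the
twisted diagonal of `h`, is the stabilizer of `u`. -/
theorem actVal_eq {X : AdmSet H} (s : EqSec F X) {u u' : U} {x x' : X.X} {q : (actAdm U hU X).X}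
    (hq : actSet.mk u x = q) (hq' : actSet.mk u' x' = q) :
    actVal U hU s u x q hq = actVal U hU s u' x' q hq' := by
  obtain ⟨h, rfl, rfl⟩ := actSet.mk_eq.1 (hq.trans hq'.symm)
  unfold actVal
  rw [← EqSec.map_conjHom s h rfl (X.stab_smul rfl)]
  symm
  refine map_restrHom_comp F _ ?_ ?_ _
  · intro b hb
    refine ⟨h⁻¹ * b * h, ?_, mem_twDiag.2 (by group)⟩
    change b • h • x = h • x at hb
    change (h⁻¹ * b * h) • x = x
    rw [mul_smul, mul_smul, hb, inv_smul_smul]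
  · intro g hg c hc
    change c • x = x at hc
    change ((g, c) : G × H) • u = u ↔
      ∃ b : H, b • h • x = h • x ∧ ((g, b) : G × H) • ((1, h) : G × H) • u = ((1, h) : G × H) • u ∧
        (b, c) ∈ twDiag h
    have key : ((g, h * c * h⁻¹) : G × H) • ((1, h) : G × H) • u =
        ((1, h) : G × H) • ((g, c) : G × H) • u := by simp [smul_smul]
    constructor
    · intro hu
      refine ⟨h * c * h⁻¹, by simp [mul_smul, hc], ?_, mem_twDiag.2 rfl⟩
      rw [key, hu]
    · rintro ⟨b, -, hb, hbc⟩
      obtain rfl := mem_twDiag.1 hbc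
      rw [key] at hb
      exact smul_left_cancel _ hb

/-- The section `U(s)` of `F` over `U ×_H X`. -/
def actSec {X : AdmSet H} (s : EqSec F X) : EqSec F (actAdm U hU X) where
  val q := actVal U hU s q.out.1 q.out.2 q (Quotient.out_eq q)
  property := by
    intro g
    funext q
    obtain ⟨u, x, hq⟩ : ∃ u x, actSet.mk u x = q := ⟨_, _, Quotient.out_eq q⟩
    -- With the representative `(g⁻¹ u, x)` of `g⁻¹ q`, equivariance says that the twisted diagonal
    -- of `g` composed with the stabilizer of `g⁻¹ u` is the stabilizer of `u`.
    have hq' : actSet.mk (((g⁻¹, 1) : G × H) • u) x = g⁻¹ • q := by rw [← hq]; rfl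
    refine (congrArg (F.obj.map _) (actVal_eq U hU s _ hq')).trans
      (Eq.trans ?_ (actVal_eq U hU s hq _))
    refine map_restrHom_comp F _ ?_ ?_ _
    · intro b hb
      exact (actSet.mem_stabilizer hq').1 hb
    · intro a ha c hc
      change ((a, c) : G × H) • u = u ↔ ∃ b : G, b • g⁻¹ • q = g⁻¹ • q ∧ (a, b) ∈ twDiag g ∧
        ((b, c) : G × H) • ((g⁻¹, 1) : G × H) • u = ((g⁻¹, 1) : G × H) • u
      change a • q = q at ha
      have key : ((g⁻¹ * a * g, c) : G × H) • ((g⁻¹, 1) : G × H) • u =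
          ((g⁻¹, 1) : G × H) • ((a, c) : G × H) • u := by simp [smul_smul]
      constructor
      · intro hu
        refine ⟨g⁻¹ * a * g, by simp [mul_smul, ha], mem_twDiag.2 (by group), ?_⟩
        rw [key, hu]
      · rintro ⟨b, -, hab, hb⟩
        obtain rfl : b = g⁻¹ * a * g := by rw [mem_twDiag.1 hab]; group
        rw [key] at hb
        exact smul_left_cancel _ hb

theorem actSec_apply {X : AdmSet H} (s : EqSec F X) {u : U} {x : X.X} {q : (actAdm U hU X).X}
    (hq : actSet.mk u x = q) : (actSec U hU s).1 q = actVal U hU s u x q hq :=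
  actVal_eq U hU s (Quotient.out_eq q) hq

theorem actSec_add {X : AdmSet H} (s t : EqSec F X) :
    actSec U hU (s + t) = actSec U hU s + actSec U hU t :=
  Subtype.ext (funext fun _ => map_add (F.obj.map _).hom _ _)

theorem actSec_smul {X : AdmSet H} (r : R) (s : EqSec F X) :
    actSec U hU (r • s) = r • actSec U hU s :=
  Subtype.ext (funext fun _ => map_smul (F.obj.map _).hom _ _)

/-- The object map of the functor `Γ_F(U)`. -/
def actGam (a : Gam F H) : Gam F G := ⟨actAdm U hU a.X, actSec U hU a.s⟩

/-- The map `U ×_H f`. -/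
def actSet.map {X Y : GSet H} (f : X → Y) (hf : ∀ (h : H) x, f (h • x) = h • f x) :
    actSet U X → actSet U Y :=
  Quotient.map (fun p => (p.1, f p.2)) (by
    rintro ⟨u, x⟩ ⟨_, _⟩ ⟨h, rfl, rfl⟩
    exact ⟨h, rfl, (hf h x).symm⟩)

/-- `G_{[u, x]} = (G × H)_u * H_x` involves `x` only through `H_x`, which `f` preserves. -/
theorem actSet.stab_map {X Y : AdmSet H} {f : X.X → Y.X} (hf : ∀ (h : H) x, f (h • x) = h • f x)
    (hs : ∀ x, X.stab x = Y.stab (f x)) (q : (actAdm U hU X).X) :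
    (actAdm U hU X).stab q = (actAdm U hU Y).stab (actSet.map U f hf q) := by
  induction q using actSet.ind with
  | _ u x =>
  ext g
  have h₁ := actSet.mem_stabilizer (U := U) (X := X.X) (u := u) (x := x) rfl (g := g)
  have h₂ := actSet.mem_stabilizer (U := U) (X := Y.X) (u := u) (x := f x) rfl (g := g)
  refine h₁.trans (Iff.trans ?_ h₂.symm)
  refine exists_congr fun h => and_congr_left fun _ => ?_
  exact SetLike.ext_iff.1 (congrArg Sg.subgroup (hs x)) h

/-- The morphism map of the functor `Γ_F(U)`. -/
def actGamMap {a b : Gam F H} (f : a ⟶ b) : actGam U hU a ⟶ actGam U hU b where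
  toFun := actSet.map U f.toFun f.map_smul
  map_smul g q := by
    induction q using actSet.ind with
    | _ u x => rfl
  stab_eq := actSet.stab_map U hU f.map_smul f.stab_eq
  section_eq q := by
    induction q using actSet.ind with
    | _ u x =>
    have h := actSet.stab_map U hU f.map_smul f.stab_eq (actSet.mk u x)
    refine (actSec_apply U hU b.s (u := u) (x := f.toFun x) rfl).trans ?_
    refine Eq.trans ?_ (congrArg (transp F h) (actSec_apply U hU a.s (u := u) (x := x) rfl).symm)
    refine (congrArg (F.obj.map _) (f.section_eq x)).trans ?_
    -- The morphism from the stabilizer of `x` to that of `[u, f(x)]`: both sides reduce to it, one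
    -- by absorbing a transport on the source, the other on the target.
    have hmem := restr_mem_congr h rfl (act_restr_mem U hU a.X (u := u) (x := x) rfl)
    exact (map_restrHom_transp F _ hmem (fun _ _ _ _ => Iff.rfl) _).trans
      (transp_map_restrHom F h hmem (fun _ _ _ _ => Iff.rfl) _).symm

end GammaFunctor

/-! ### Canonical isomorphisms for `U ×_H X` -/

section

variable {G H K : Type u} [Group G] [Group H] [Group K]

/-- `U ×_H (X ⨿ Y)` is `(U ×_H X) ⨿ (U ×_H Y)`. -/
def actSet.sumRight (U : GSet (G × H)) (X Y : GSet H) :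
    GSet.Iso ((actSet U X).sum (actSet U Y)) (actSet U (X.sum Y)) where
  toEquiv :=
    { toFun := Sum.elim
        (Quotient.map (fun p => (p.1, Sum.inl p.2)) (by
          rintro ⟨u, x⟩ ⟨_, _⟩ ⟨h, rfl, rfl⟩
          exact ⟨h, rfl, rfl⟩))
        (Quotient.map (fun p => (p.1, Sum.inr p.2)) (by
          rintro ⟨u, x⟩ ⟨_, _⟩ ⟨h, rfl, rfl⟩
          exact ⟨h, rfl, rfl⟩))
      invFun := Quotient.lift
        (fun p => Sum.map (fun x => actSet.mk p.1 x) (fun x => actSet.mk p.1 x) p.2) (by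
          rintro ⟨u, x | x⟩ ⟨_, _⟩ ⟨h, rfl, rfl⟩
          · exact congrArg Sum.inl (actSet.mk_eq.2 ⟨h, rfl, rfl⟩)
          · exact congrArg Sum.inr (actSet.mk_eq.2 ⟨h, rfl, rfl⟩))
      left_inv := by rintro (⟨u, x⟩ | ⟨u, x⟩) <;> rfl
      right_inv := by rintro ⟨u, x | x⟩ <;> rfl }
  map_smul := by rintro g (⟨u, x⟩ | ⟨u, x⟩) <;> rfl

/-- `(U ⨿ V) ×_H X` is `(U ×_H X) ⨿ (V ×_H X)`. -/
def actSet.sumLeft (U V : GSet (G × H)) (X : GSet H) :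
    GSet.Iso ((actSet U X).sum (actSet V X)) (actSet (U.sum V) X) where
  toEquiv :=
    { toFun := Sum.elim
        (Quotient.map (fun p => (Sum.inl p.1, p.2)) (by
          rintro ⟨u, x⟩ ⟨_, _⟩ ⟨h, rfl, rfl⟩
          exact ⟨h, rfl, rfl⟩))
        (Quotient.map (fun p => (Sum.inr p.1, p.2)) (by
          rintro ⟨u, x⟩ ⟨_, _⟩ ⟨h, rfl, rfl⟩
          exact ⟨h, rfl, rfl⟩))
      invFun := Quotient.lift
        (fun p => Sum.map (fun u => actSet.mk u p.2) (fun u => actSet.mk u p.2) p.1) (by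
          rintro ⟨u | u, x⟩ ⟨_, _⟩ ⟨h, rfl, rfl⟩
          · exact congrArg Sum.inl (actSet.mk_eq.2 ⟨h, rfl, rfl⟩)
          · exact congrArg Sum.inr (actSet.mk_eq.2 ⟨h, rfl, rfl⟩))
      left_inv := by rintro (⟨u, x⟩ | ⟨u, x⟩) <;> rfl
      right_inv := by rintro ⟨u | u, x⟩ <;> rfl }
  map_smul := by rintro g (⟨u, x⟩ | ⟨u, x⟩) <;> rfl

/-- Functoriality of `U ×_H X` for isomorphisms in `U`. -/
def actSet.congrLeft {U V : GSet (G × H)} (e : GSet.Iso U V) (X : GSet H) :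
    GSet.Iso (actSet U X) (actSet V X) where
  toEquiv := Quotient.congr (Equiv.prodCongr e.toEquiv (Equiv.refl _)) (by
    rintro ⟨u, v⟩ ⟨u', v'⟩
    refine exists_congr fun h => ?_
    simp only [Equiv.prodCongr_apply, Prod.map_apply, ← e.map_smul,
      EmbeddingLike.apply_eq_iff_eq, Equiv.refl_apply])
  map_smul := by
    rintro a ⟨u, v⟩
    exact congrArg (Quotient.mk _) (Prod.ext (e.map_smul _ _) rfl)

/-- `G ×_G X` is `X`. -/
def actSet.regular [Finite G] (X : GSet G) : GSet.Iso (actSet (regular G) X) X where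
  toEquiv :=
    { toFun := Quotient.lift (fun p : G × X => p.1 • p.2) (by
        rintro ⟨(g : G), x⟩ ⟨_, _⟩ ⟨h, rfl, rfl⟩
        change g • x = (1 * g * h⁻¹) • h • x
        simp [smul_smul])
      invFun := fun x => actSet.mk (U := BisetPlus.regular G) (1 : G) x
      left_inv := by
        rintro ⟨(g : G), x⟩
        refine actSet.mk_eq.2 ⟨g⁻¹, ?_, ?_⟩
        · change 1 * 1 * g⁻¹⁻¹ = g
          simp
        · change g⁻¹ • g • x = x
          simp
      right_inv := fun x => one_smul G x }
  map_smul := by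
    rintro a ⟨(g : G), x⟩
    change (a * g * 1⁻¹) • x = a • g • x
    simp [smul_smul]

/-- `(U ×_H V) ×_K X` is `U ×_H (V ×_K X)`. -/
def actSet.assoc (U : GSet (G × H)) (V : GSet (H × K)) (X : GSet K) :
    GSet.Iso (actSet (tens U V) X) (actSet U (actSet V X)) where
  toEquiv :=
    { toFun := Quotient.lift (fun p => Quotient.lift
        (fun y => actSet.mk y.1 (actSet.mk y.2 p.2)) (by
          rintro ⟨u, v⟩ ⟨_, _⟩ ⟨h, rfl, rfl⟩
          exact actSet.mk_eq.2 ⟨h, rfl, rfl⟩) p.1) (by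
        rintro ⟨⟨u, v⟩, x⟩ ⟨_, _⟩ ⟨k, rfl, rfl⟩
        -- `K` acts only on the factor `V`, so the outer relation uses `1 ∈ H` and `k` is spent in
        -- the inner one.
        refine actSet.mk_eq.2 ⟨1, rfl, ?_⟩
        rw [actSet.smul_mk]
        exact actSet.mk_eq.2 ⟨k, by simp [one_one_smul], rfl⟩)
      invFun := Quotient.lift (fun p => Quotient.lift
        (fun y => actSet.mk (tens.mk p.1 y.1) y.2) (by
          rintro ⟨v, x⟩ ⟨_, _⟩ ⟨k, rfl, rfl⟩
          refine actSet.mk_eq.2 ⟨k, ?_, rfl⟩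
          rw [tens.smul_mk]
          exact congrArg (fun t => tens.mk t _) (one_smul (G × H) _)) p.2) (by
        rintro ⟨u, ⟨v, x⟩⟩ ⟨_, _⟩ ⟨h, rfl, rfl⟩
        refine actSet.mk_eq.2 ⟨1, ?_, one_smul _ _⟩
        rw [tens.smul_mk]
        exact tens.mk_eq.2 ⟨h, by simp [one_one_smul], by simp [one_one_smul]⟩)
      left_inv := by
        rintro ⟨⟨u, v⟩, x⟩
        rfl
      right_inv := by
        rintro ⟨u, ⟨v, x⟩⟩
        rfl }
  map_smul := by
    rintro a ⟨⟨u, v⟩, x⟩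
    refine congrArg (fun t => actSet.mk _ (actSet.mk t _)) ?_
    exact one_smul (H × K) _

end

/-! ### The maps `F₊([U])` -/

section FPlusMaps

variable {α : Type u} {P : BisetSystem α} [P.RestrictionClosed] {R : Type w} [CommRing R]
  {F : BisetFunctor.{u, v} P R} {G H K : P.Obj}

/-- Additive maps out of `F₊(G)`. -/
def FPlus.lift {B : Type*} [AddCommGroup B] (f : Gam F G → B) (hiso : ∀ a b, (a ≅ b) → f a = f b)
    (hsum : ∀ a b, f (a.coprod b) = f a + f b)
    (hadd : ∀ (X : AdmSet G) (s t : EqSec F X), f ⟨X, s + t⟩ = f ⟨X, s⟩ + f ⟨X, t⟩) :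
    FPlus F G →+ B :=
  QuotientAddGroup.lift (plusRel F G)
    (FreeAbelianGroup.lift (Quotient.lift f (fun a b h => hiso a b h.some))) (by
      refine (AddSubgroup.closure_le _).2 ?_
      rintro _ (⟨a, b⟩ | ⟨X, s, t⟩)
      · refine (AddMonoidHom.mem_ker).2 ?_
        simp only [map_sub, gamOf, FreeAbelianGroup.lift_apply_of]
        exact (sub_sub _ _ _).trans (sub_eq_zero.2 (hsum a b))
      · refine (AddMonoidHom.mem_ker).2 ?_
        simp only [map_sub, gamOf, FreeAbelianGroup.lift_apply_of]
        exact (sub_sub _ _ _).trans (sub_eq_zero.2 (hadd X s t)))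

theorem FPlus.lift_mk {B : Type*} [AddCommGroup B] (f : Gam F G → B) (hiso hsum hadd) (a : Gam F G) :
    FPlus.lift f hiso hsum hadd (mk a) = f a :=
  FreeAbelianGroup.lift_apply_of _ _

/-- Linear maps out of `F₊(G)`. -/
def FPlus.liftLinear {B : Type*} [AddCommGroup B] [Module R B] (f : Gam F G → B)
    (hiso : ∀ a b, (a ≅ b) → f a = f b) (hsum : ∀ a b, f (a.coprod b) = f a + f b)
    (hadd : ∀ (X : AdmSet G) (s t : EqSec F X), f ⟨X, s + t⟩ = f ⟨X, s⟩ + f ⟨X, t⟩)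
    (hsmul : ∀ (r : R) a, f (a.smul r) = r • f a) : FPlus F G →ₗ[R] B where
  toFun := FPlus.lift f hiso hsum hadd
  map_add' := map_add _
  map_smul' r x := by
    have h : (FPlus.lift f hiso hsum hadd).comp (FPlus.smulHom r) =
        (DistribSMul.toAddMonoidHom B r).comp (FPlus.lift f hiso hsum hadd) := by
      apply FPlus.hom_ext
      intro a
      simp [FPlus.smulHom_mk, FPlus.lift_mk, hsmul]
    exact DFunLike.congr_fun h x

theorem FPlus.liftLinear_mk {B : Type*} [AddCommGroup B] [Module R B] (f : Gam F G → B)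
    (hiso hsum hadd hsmul) (a : Gam F G) :
    FPlus.liftLinear (R := R) f hiso hsum hadd hsmul (mk a) = f a :=
  FPlus.lift_mk f hiso hsum hadd a

theorem FPlus.linearMap_ext {B : Type*} [AddCommGroup B] [Module R B] {f g : FPlus F G →ₗ[R] B}
    (h : ∀ a, f (mk a) = g (mk a)) : f = g := by
  have h' : f.toAddMonoidHom = g.toAddMonoidHom := FPlus.hom_ext h
  exact LinearMap.ext fun x => DFunLike.congr_fun h' x

theorem FPlus.mk_eq_of_catIso {a b : Gam F G} (e : a ≅ b) : mk a = mk b :=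
  congrArg (QuotientAddGroup.mk' (plusRel F G)) (congrArg FreeAbelianGroup.of (Quotient.sound ⟨e⟩))

section

variable (U : GSet (G × H)) (hU : ∀ u : U, MulAction.stabilizer (G × H) u ∈ P.SPlus G.grp H.grp)

/-- `Γ_F(U)` on isomorphisms. -/
def actGamIso {a b : Gam F H} (e : a ≅ b) : actGam U hU a ≅ actGam U hU b where
  hom := actGamMap U hU e.hom
  inv := actGamMap U hU e.inv
  hom_inv_id := by
    refine Gam.Hom.ext (funext fun q => ?_)
    induction q using actSet.ind with
    | _ u x => exact congrArg (actSet.mk u) (congrFun (congrArg Gam.Hom.toFun e.hom_inv_id) x)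
  inv_hom_id := by
    refine Gam.Hom.ext (funext fun q => ?_)
    induction q using actSet.ind with
    | _ u x => exact congrArg (actSet.mk u) (congrFun (congrArg Gam.Hom.toFun e.inv_hom_id) x)

theorem mk_actGam_coprod (a b : Gam F H) : FPlus.mk (actGam U hU (a.coprod b)) =
    FPlus.mk (actGam U hU a) + FPlus.mk (actGam U hU b) := by
  rw [← FPlus.mk_coprod]
  symm
  refine FPlus.mk_eq_of_iso (actSet.sumRight U a.X.X b.X.X) ?_
  rintro (q | q) h
  · induction q using actSet.ind with
    | _ u x =>
    -- The mixed form, with target stabilizer computed in `U ×_H (X ⨿ Y)` and source stabilizer in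
    -- `X`; both sides are reduced to it.
    have hmem := restr_mem_congr rfl (a.X.stab_inl b.X x).symm
      (act_restr_mem U hU (a.coprod b).X (u := u) (x := Sum.inl x) rfl)
    refine (actSec_apply U hU (a.coprod b).s (u := u) (x := Sum.inl x) rfl).trans ?_
    refine (map_restrHom_transp F _ hmem (fun _ _ _ _ => Iff.rfl) _).trans ?_
    refine Eq.trans ?_ (transp_transp F _ h _).symm
    refine Eq.trans ?_ (congrArg (transp F _) (actSec_apply U hU a.s (u := u) (x := x) rfl).symm)
    exact (transp_map_restrHom F _ hmem (fun _ _ _ _ => Iff.rfl) _).symm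
  · induction q using actSet.ind with
    | _ u x =>
    have hmem := restr_mem_congr rfl (a.X.stab_inr b.X x).symm
      (act_restr_mem U hU (a.coprod b).X (u := u) (x := Sum.inr x) rfl)
    refine (actSec_apply U hU (a.coprod b).s (u := u) (x := Sum.inr x) rfl).trans ?_
    refine (map_restrHom_transp F _ hmem (fun _ _ _ _ => Iff.rfl) _).trans ?_
    refine Eq.trans ?_ (transp_transp F _ h _).symm
    refine Eq.trans ?_ (congrArg (transp F _) (actSec_apply U hU b.s (u := u) (x := x) rfl).symm)
    exact (transp_map_restrHom F _ hmem (fun _ _ _ _ => Iff.rfl) _).symm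

/-- The map `F₊([U]) : F₊(H) → F₊(G)`. -/
def actMap : FPlus F H →ₗ[R] FPlus F G :=
  FPlus.liftLinear (fun a => FPlus.mk (actGam U hU a))
    (fun _ _ e => FPlus.mk_eq_of_catIso (actGamIso U hU e))
    (mk_actGam_coprod U hU)
    (fun X s t => by
      refine Eq.trans ?_ (FPlus.mk_add (actAdm U hU X) (actSec U hU s) (actSec U hU t))
      exact congrArg (fun s => FPlus.mk ⟨_, s⟩) (actSec_add U hU s t))
    (fun r a => by
      rw [FPlus.smul_mk]
      exact congrArg (fun s => FPlus.mk ⟨_, s⟩) (actSec_smul U hU r a.s))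

theorem actMap_mk (a : Gam F H) : actMap U hU (FPlus.mk a) = FPlus.mk (actGam U hU a) :=
  FPlus.liftLinear_mk _ _ _ _ _ a

end

theorem actMap_congr {U V : GSet (G × H)} (e : GSet.Iso U V)
    (hU : ∀ u : U, MulAction.stabilizer (G × H) u ∈ P.SPlus G.grp H.grp)
    (hV : ∀ u : V, MulAction.stabilizer (G × H) u ∈ P.SPlus G.grp H.grp) :
    actMap (F := F) U hU = actMap V hV := by
  refine FPlus.linearMap_ext fun a => ?_
  rw [actMap_mk, actMap_mk]
  refine FPlus.mk_eq_of_iso (actSet.congrLeft e a.X.X) fun q h => ?_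
  induction q using actSet.ind with
  | _ u x =>
  refine (actSec_apply V hV a.s (u := e.toEquiv u) (x := x) rfl).trans ?_
  refine Eq.trans ?_ (congrArg (transp F h) (actSec_apply U hU a.s (u := u) (x := x) rfl).symm)
  refine (transp_map_restrHom F h _ (fun g _ k _ => ?_) _).symm
  change ((g, k) : G × H) • e.toEquiv u = e.toEquiv u ↔ ((g, k) : G × H) • u = u
  rw [← e.map_smul, e.toEquiv.injective.eq_iff]

theorem actMap_sum {U V : GSet (G × H)}
    (hU : ∀ u : U, MulAction.stabilizer (G × H) u ∈ P.SPlus G.grp H.grp)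
    (hV : ∀ u : V, MulAction.stabilizer (G × H) u ∈ P.SPlus G.grp H.grp)
    (hUV : ∀ u : U.sum V, MulAction.stabilizer (G × H) u ∈ P.SPlus G.grp H.grp) :
    actMap (F := F) (U.sum V) hUV = actMap U hU + actMap V hV := by
  refine FPlus.linearMap_ext fun a => ?_
  rw [LinearMap.add_apply, actMap_mk, actMap_mk, actMap_mk, ← FPlus.mk_coprod]
  symm
  refine FPlus.mk_eq_of_iso (actSet.sumLeft U V a.X.X) ?_
  rintro (q | q) h
  · induction q using actSet.ind with
    | _ u x =>
    refine (actSec_apply (U.sum V) hUV a.s (u := Sum.inl u) (x := x) rfl).trans ?_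
    refine Eq.trans ?_ (transp_transp F _ h _).symm
    refine Eq.trans ?_ (congrArg (transp F _) (actSec_apply U hU a.s (u := u) (x := x) rfl).symm)
    exact (transp_map_restrHom F _ _ (fun g _ k _ => Sum.inl_injective.eq_iff) _).symm
  · induction q using actSet.ind with
    | _ u x =>
    refine (actSec_apply (U.sum V) hUV a.s (u := Sum.inr u) (x := x) rfl).trans ?_
    refine Eq.trans ?_ (transp_transp F _ h _).symm
    refine Eq.trans ?_ (congrArg (transp F _) (actSec_apply V hV a.s (u := u) (x := x) rfl).symm)
    exact (transp_map_restrHom F _ _ (fun g _ k _ => Sum.inr_injective.eq_iff) _).symm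

/-- The stabilizer of `g` in the regular biset is the twisted diagonal of `g`, so the value of the
new section at `[g, x]` is `ᵍ(s(x)) = s(gx)`. -/
theorem actMap_regular
    (hG : ∀ u : regular G, MulAction.stabilizer (G × G) u ∈ P.SPlus G.grp G.grp) :
    actMap (F := F) (regular G) hG = LinearMap.id := by
  refine FPlus.linearMap_ext fun a => ?_
  rw [LinearMap.id_apply, actMap_mk]
  refine FPlus.mk_eq_of_iso (actSet.regular a.X.X) fun q h => ?_
  induction q using actSet.ind with
  | _ g x =>
  refine Eq.trans ?_ (congrArg (transp F h)
    (actSec_apply (regular G) hG a.s (u := g) (x := x) rfl).symm)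
  refine (EqSec.map_conjHom a.s g rfl (a.X.stab_smul rfl)).symm.trans
    (transp_map_restrHom F h _ (fun b _ c _ => ?_) _).symm
  refine mem_twDiag.trans ?_
  have key (b c g : G) : b = g * c * g⁻¹ ↔ b * g * c⁻¹ = g := by
    rw [mul_inv_eq_iff_eq_mul, eq_mul_inv_iff_mul_eq]
  exact key b c g

/-- The value at `[u, [v, x]]` is a composite through `F(H_{[v, x]})`. Each element of `H_{[v, x]}`
is paired with one of `K_x` by the stabilizer of `v`, so the single-term Mackey formula applies, and
the stabilizer of `[u, v]` is the `*`-product of the two stabilizers. -/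
theorem actMap_tens {U : GSet (G × H)} {V : GSet (H × K)}
    (hU : ∀ u : U, MulAction.stabilizer (G × H) u ∈ P.SPlus G.grp H.grp)
    (hV : ∀ u : V, MulAction.stabilizer (H × K) u ∈ P.SPlus H.grp K.grp)
    (hUV : ∀ u : tens U V, MulAction.stabilizer (G × K) u ∈ P.SPlus G.grp K.grp) :
    actMap (F := F) (tens U V) hUV = actMap U hU ∘ₗ actMap V hV := by
  refine FPlus.linearMap_ext fun a => ?_
  rw [LinearMap.comp_apply, actMap_mk, actMap_mk, actMap_mk]
  refine FPlus.mk_eq_of_iso (actSet.assoc U V a.X.X) fun q h => ?_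
  induction q using actSet.ind with
  | _ p x =>
  induction p using tens.ind with
  | _ u v =>
  have hmem := restr_mem_congr h rfl
    (act_restr_mem (tens U V) hUV a.X (u := tens.mk u v) (x := x) rfl)
  refine (actSec_apply U hU (actSec V hV a.s) (u := u) (x := actSet.mk v x) rfl).trans ?_
  refine Eq.trans ?_ (congrArg (transp F h)
    (actSec_apply (tens U V) hUV a.s (u := tens.mk u v) (x := x) rfl).symm)
  refine Eq.trans ?_ (transp_map_restrHom F h hmem (fun _ _ _ _ => Iff.rfl) _).symm
  refine (congrArg (F.obj.map _) (actSec_apply V hV a.s (u := v) (x := x) rfl)).trans ?_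
  refine map_restrHom_comp F hmem ?_ ?_ _
  · intro b hb
    exact (actSet.mem_stabilizer (U := V) (X := a.X.X) (u := v) (x := x) rfl).1 hb
  · intro g _ c hc
    refine (SetLike.ext_iff.1 (tens.stabilizer_mk u v) (g, c)).trans (exists_congr fun b => ?_)
    constructor
    · rintro ⟨h₁, h₂⟩
      -- That `b` fixes `[v, x]` is automatic: `(b, c)` fixes `v` and `c` fixes `x`.
      exact ⟨(actSet.mem_stabilizer (U := V) (X := a.X.X) rfl).2 ⟨c, hc, h₂⟩, h₁, h₂⟩
    · exact And.right

end FPlusMaps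

/-! ### Point stabilizers in translates, subsets and disjoint unions -/

theorem stabilizer_smul_conjSub {A X : Type*} [Group A] [MulAction A X] (a : A) (x : X) :
    MulAction.stabilizer A (a • x) = conjSub a (MulAction.stabilizer A x) := by
  ext b
  rw [mem_conjSub, MulAction.mem_stabilizer_iff, MulAction.mem_stabilizer_iff, mul_smul, mul_smul,
    inv_smul_eq_iff]

theorem GSet.stabilizer_ofSet {A : Type u} [Group A] [Finite A] (X : GSet A) (s : Set X)
    (hs : ∀ (a : A), ∀ x ∈ s, a • x ∈ s) (x : X.ofSet s hs) :
    MulAction.stabilizer A x = MulAction.stabilizer A x.1 := by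
  ext a
  exact Subtype.ext_iff

theorem GSet.Iso.stabilizer_eq {A : Type u} [Group A] {X Y : GSet A} (e : GSet.Iso X Y) (x : X) :
    MulAction.stabilizer A (e.toEquiv x) = MulAction.stabilizer A x := by
  ext a
  rw [MulAction.mem_stabilizer_iff, MulAction.mem_stabilizer_iff, ← e.map_smul,
    e.toEquiv.injective.eq_iff]

theorem GSet.stabilizer_inl {A : Type u} [Group A] {X Y : GSet A} (x : X) :
    MulAction.stabilizer A (show X.sum Y from Sum.inl x) = MulAction.stabilizer A x := by
  ext a
  exact Sum.inl_injective.eq_iff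

theorem GSet.stabilizer_inr {A : Type u} [Group A] {X Y : GSet A} (y : Y) :
    MulAction.stabilizer A (show X.sum Y from Sum.inr y) = MulAction.stabilizer A y := by
  ext a
  exact Sum.inr_injective.eq_iff

/-! ### The action of the Burnside group on `F₊` -/

section BurnsideAction

variable {α : Type u} {P : BisetSystem α} {G H K : P.Obj}

theorem mem_SPlus_inl {U V : GSet (G × H)} (u : U) :
    MulAction.stabilizer (G × H) (show U.sum V from Sum.inl u) ∈ P.SPlus G.grp H.grp ↔
      MulAction.stabilizer (G × H) u ∈ P.SPlus G.grp H.grp := by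
  rw [GSet.stabilizer_inl]

theorem mem_SPlus_inr {U V : GSet (G × H)} (v : V) :
    MulAction.stabilizer (G × H) (show U.sum V from Sum.inr v) ∈ P.SPlus G.grp H.grp ↔
      MulAction.stabilizer (G × H) v ∈ P.SPlus G.grp H.grp := by
  rw [GSet.stabilizer_inr]

variable [P.RestrictionClosed]

/-- The part of a biset consisting of the elements with stabilizer in `𝒮₊(G, H)`. -/
def plusPart (U : GSet (G × H)) : GSet (G × H) :=
  U.ofSet (fun u => MulAction.stabilizer (G × H) u ∈ P.SPlus G.grp H.grp) (fun a u hu => by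
    have h := SPlus_conj G.mem H.mem hu a
    rw [← stabilizer_smul_conjSub a u] at h
    exact h)

theorem plusPart_mem (U : GSet (G × H)) (u : plusPart U) :
    MulAction.stabilizer (G × H) u ∈ P.SPlus G.grp H.grp :=
  (GSet.stabilizer_ofSet U _ _ u).symm ▸ u.2

/-- `plusPart U` is `U` if all stabilizers are in `𝒮₊(G, H)`. -/
def plusPartIso {U : GSet (G × H)}
    (hU : ∀ u : U, MulAction.stabilizer (G × H) u ∈ P.SPlus G.grp H.grp) :
    GSet.Iso (plusPart U) U :=
  ⟨⟨Subtype.val, fun u => ⟨u, hU u⟩, fun _ => rfl, fun _ => rfl⟩, fun _ _ => rfl⟩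

/-- Functoriality of `plusPart` for isomorphisms. -/
def plusPartCongr {U V : GSet (G × H)} (e : GSet.Iso U V) :
    GSet.Iso (plusPart U) (plusPart V) :=
  ⟨e.toEquiv.subtypeEquiv fun u =>
      (congrArg (· ∈ P.SPlus G.grp H.grp) (e.stabilizer_eq u)).symm.to_iff,
    fun a u => Subtype.ext (e.map_smul a u.1)⟩

/-- `plusPart` commutes with disjoint unions. -/
def plusPartSum (U V : GSet (G × H)) :
    GSet.Iso (plusPart (U.sum V)) ((plusPart U).sum (plusPart V)) where
  toEquiv :=
    { toFun := fun
        | ⟨Sum.inl u, h⟩ => Sum.inl ⟨u, (mem_SPlus_inl u).1 h⟩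
        | ⟨Sum.inr v, h⟩ => Sum.inr ⟨v, (mem_SPlus_inr v).1 h⟩
      invFun := Sum.elim (fun u => ⟨Sum.inl u.1, (mem_SPlus_inl u.1).2 u.2⟩)
        (fun v => ⟨Sum.inr v.1, (mem_SPlus_inr v.1).2 v.2⟩)
      left_inv := by rintro ⟨u | v, h⟩ <;> rfl
      right_inv := by rintro (u | v) <;> rfl }
  map_smul := by rintro a ⟨u | v, h⟩ <;> rfl

variable {R : Type w} [CommRing R]

/-- Discarding points with unsuitable stabilizers is additive. This allows the universal property of
the full group `B(G, H)` to be used, with no description of the relations in its subgroup of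
morphisms. -/
theorem actMap_plusPart_sum (F : BisetFunctor.{u, v} P R) (U V : GSet (G × H)) :
    actMap (F := F) (plusPart (U.sum V)) (plusPart_mem _) =
      actMap (plusPart U) (plusPart_mem U) + actMap (plusPart V) (plusPart_mem V) := by
  have h : ∀ w : (plusPart U).sum (plusPart V),
      MulAction.stabilizer (G × H) w ∈ P.SPlus G.grp H.grp := by
    rintro (w | w)
    · exact (mem_SPlus_inl w).2 (plusPart_mem U w)
    · exact (mem_SPlus_inr w).2 (plusPart_mem V w)
  rw [actMap_congr (plusPartSum U V) _ h, actMap_sum]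

variable (F : BisetFunctor.{u, v} P R) (G H) in
/-- The action of isomorphism classes of `(G, H)`-bisets on `F₊`, through the part of the biset
with stabilizers in `𝒮₊(G, H)`. -/
def bmonAct : BMon (G × H) →+ (FPlus F H →ₗ[R] FPlus F G) where
  toFun := Quotient.lift (fun U => actMap (plusPart U) (plusPart_mem U))
    (fun _ _ ⟨e⟩ => actMap_congr (plusPartCongr e) _ _)
  map_zero' := by
    -- The empty biset is the disjoint union of two copies of itself, so its image `z` satisfies `z
    -- = z + z`.
    refine left_eq_add.1 ((actMap_congr (plusPartCongr ?_) _ _).trans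
      (actMap_plusPart_sum F (GSet.empty : GSet (G × H)) GSet.empty))
    exact ⟨(Equiv.emptySum PEmpty PEmpty).symm, fun _ x => x.elim⟩
  map_add' := by
    rintro ⟨U⟩ ⟨V⟩
    exact actMap_plusPart_sum F U V

variable (F : BisetFunctor.{u, v} P R) (G H) in
/-- The action of the Burnside group of `(G, H)`-bisets on `F₊`. -/
def burnsideAct : Burnside (G × H) →+ (FPlus F H →ₗ[R] FPlus F G) :=
  Algebra.GrothendieckAddGroup.lift (bmonAct G H F)

theorem burnsideAct_cls (F : BisetFunctor.{u, v} P R) (U : GSet (G × H))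
    (hU : ∀ u : U, MulAction.stabilizer (G × H) u ∈ P.SPlus G.grp H.grp) :
    burnsideAct G H F (cls U) = actMap U hU :=
  (lift_cls (bmonAct G H F) U).trans (actMap_congr (plusPartIso hU) _ _)

theorem burnsideAct_regular (F : BisetFunctor.{u, v} P R) (G : P.Obj) :
    burnsideAct G G F (cls (regular G)) = LinearMap.id := by
  have hG : ∀ u : regular G, MulAction.stabilizer (G × G) u ∈ P.SPlus G.grp G.grp := by
    intro (g : G)
    have h : MulAction.stabilizer (G × G) (show regular G from g) = twDiag g := by
      ext ⟨a, b⟩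
      rw [MulAction.mem_stabilizer_iff, mem_twDiag]
      change a * g * b⁻¹ = g ↔ _
      rw [mul_inv_eq_iff_eq_mul, eq_mul_inv_iff_mul_eq]
    exact Set.mem_of_eq_of_mem h (SPlus_conj G.mem G.mem (SPlus_diag G.grp G.mem) _)
  rw [burnsideAct_cls F _ hG, actMap_regular]

/-- The restriction to the subgroups of morphisms matters: discarding points in two arbitrary
factors need not agree with discarding points in their tensor product. By bilinearity only
transitive bisets are to be checked, where nothing is discarded and `actMap_tens` applies. -/
theorem burnsideAct_comp (F : BisetFunctor.{u, v} P R) {x : Burnside (G × H)}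
    {y : Burnside (H × K)} 
    (hx : x ∈ AddSubgroup.closure {b | ∃ D ∈ P.SPlus G.grp H.grp, b = cls (GSet.coset D)})
    (hy : y ∈ AddSubgroup.closure {b | ∃ D ∈ P.SPlus H.grp K.grp, b = cls (GSet.coset D)}) :
    burnsideAct G K F (comp x y) = burnsideAct G H F x ∘ₗ burnsideAct H K F y := by
  induction hx using AddSubgroup.closure_induction with
  | zero => simp
  | add a b _ _ ha hb => simp only [map_add, AddMonoidHom.add_apply, ha, hb, LinearMap.add_comp]
  | neg a _ ha => simp only [map_neg, AddMonoidHom.neg_apply, ha, LinearMap.neg_comp]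
  | mem x hx =>
  obtain ⟨D, hD, rfl⟩ := hx
  induction hy using AddSubgroup.closure_induction with
  | zero => simp
  | add a b _ _ ha hb => simp only [map_add, ha, hb, LinearMap.comp_add]
  | neg a _ ha => simp only [map_neg, ha, LinearMap.comp_neg]
  | mem y hy =>
  obtain ⟨E, hE, rfl⟩ := hy
  have hU := stabilizer_coset_mem (G := G.toPlus) (H := H.toPlus) hD
  have hV := stabilizer_coset_mem (G := H.toPlus) (H := K.toPlus) hE
  have hUV : ∀ w : tens (GSet.coset D) (GSet.coset E),
      MulAction.stabilizer (G × K) w ∈ P.SPlus G.grp K.grp := by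
    intro w
    induction w using tens.ind with
    | _ p q =>
    exact Set.mem_of_eq_of_mem (tens.stabilizer_mk p q) (SPlus_star H.mem K.mem (hU p) (hV q))
  refine (congrArg _ (comp_cls (GSet.coset D) (GSet.coset E))).trans ?_
  exact (burnsideAct_cls F _ hUV).trans ((actMap_tens hU hV hUV).trans
    (congrArg₂ LinearMap.comp (burnsideAct_cls F _ hU).symm (burnsideAct_cls F _ hV).symm))

end BurnsideAction

/-! ## Sums over orbits -/

section OrbitSum

variable {A : Type u} [Group A] {B : Type*} [AddCommMonoid B]

instance (X : GSet A) : Finite (MulAction.orbitRel.Quotient A X) :=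
  inferInstanceAs (Finite (Quotient _))

/-- The sum of an invariant function over the orbits of an `A`-set. -/
def orbitSum (X : GSet A) (c : X → B) (hc : ∀ (a : A) x, c (a • x) = c x) : B :=
  letI := Fintype.ofFinite (MulAction.orbitRel.Quotient A X)
  ∑ o : MulAction.orbitRel.Quotient A X, Quotient.lift c (by
    rintro _ x ⟨a, rfl⟩
    exact hc a x) o

theorem orbitSum_iso {X Y : GSet A} (e : GSet.Iso X Y) {c : X → B} {d : Y → B}
    (hc : ∀ (a : A) x, c (a • x) = c x) (hd : ∀ (a : A) y, d (a • y) = d y)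
    (h : ∀ x, c x = d (e.toEquiv x)) : orbitSum X c hc = orbitSum Y d hd := by
  let := Fintype.ofFinite (MulAction.orbitRel.Quotient A X)
  let := Fintype.ofFinite (MulAction.orbitRel.Quotient A Y)
  refine Fintype.sum_equiv (Quotient.congr e.toEquiv ?_) _ _ ?_
  · intro x y
    refine exists_congr fun a => ?_
    exact (e.toEquiv.injective.eq_iff (a := a • y)).symm.trans (by rw [e.map_smul])
  · rintro ⟨x⟩
    exact h x

theorem orbitSum_add (X : GSet A) {c d : X → B} (hc : ∀ (a : A) x, c (a • x) = c x)
    (hd : ∀ (a : A) x, d (a • x) = d x) (hcd : ∀ (a : A) x, (c + d) (a • x) = (c + d) x) :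
    orbitSum X (c + d) hcd = orbitSum X c hc + orbitSum X d hd := by
  let := Fintype.ofFinite (MulAction.orbitRel.Quotient A X)
  refine (Finset.sum_congr rfl ?_).trans Finset.sum_add_distrib
  rintro ⟨x⟩ -
  rfl

/-- The orbits of a disjoint union. -/
def orbitsSum (X Y : GSet A) :
    MulAction.orbitRel.Quotient A X ⊕ MulAction.orbitRel.Quotient A Y ≃
      MulAction.orbitRel.Quotient A (X.sum Y) where
  toFun := Sum.elim
    (Quotient.map Sum.inl (by
      rintro _ x ⟨a, rfl⟩
      exact ⟨a, rfl⟩))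
    (Quotient.map Sum.inr (by
      rintro _ x ⟨a, rfl⟩
      exact ⟨a, rfl⟩))
  invFun := Quotient.lift (Sum.map (Quotient.mk _) (Quotient.mk _)) (by
    rintro _ (x | x) ⟨a, rfl⟩
    · exact congrArg Sum.inl (Quotient.sound ⟨a, rfl⟩)
    · exact congrArg Sum.inr (Quotient.sound ⟨a, rfl⟩))
  left_inv := by rintro (x | x) <;> induction x using Quotient.ind <;> rfl
  right_inv := by rintro ⟨x | x⟩ <;> rfl

theorem orbitSum_sum (X Y : GSet A) {c : X → B} {d : Y → B} {b : X.sum Y → B}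
    (hc : ∀ (a : A) x, c (a • x) = c x) (hd : ∀ (a : A) x, d (a • x) = d x)
    (hb : ∀ (a : A) x, b (a • x) = b x) (hl : ∀ x, b (Sum.inl x) = c x)
    (hr : ∀ y, b (Sum.inr y) = d y) :
    orbitSum (X.sum Y) b hb = orbitSum X c hc + orbitSum Y d hd := by
  let := Fintype.ofFinite (MulAction.orbitRel.Quotient A X)
  let := Fintype.ofFinite (MulAction.orbitRel.Quotient A Y)
  let := Fintype.ofFinite (MulAction.orbitRel.Quotient A (X.sum Y))
  refine ((orbitsSum X Y).sum_comp _).symm.trans ((Fintype.sum_sum_type _).trans ?_)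
  refine congrArg₂ (· + ·) (Finset.sum_congr rfl ?_) (Finset.sum_congr rfl ?_)
  · rintro ⟨x⟩ -
    exact hl x
  · rintro ⟨x⟩ -
    exact hr x

theorem orbitSum_of_transitive (X : GSet A) {c : X → B} (hc : ∀ (a : A) x, c (a • x) = c x) (x : X)
    (hx : ∀ y : X, ∃ a : A, a • x = y) : orbitSum X c hc = c x := by
  have : Subsingleton (MulAction.orbitRel.Quotient A X) := by
    refine ⟨?_⟩
    rintro ⟨y⟩ ⟨z⟩
    obtain ⟨a, rfl⟩ := hx y
    obtain ⟨b, rfl⟩ := hx z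
    exact Quotient.sound ⟨a * b⁻¹, by simp [smul_smul]⟩
  let := Fintype.ofFinite (MulAction.orbitRel.Quotient A X)
  exact Fintype.sum_subsingleton _ (Quotient.mk _ x)

end OrbitSum

/-! ### Conjugation maps -/

section Conjugation

variable {α : Type u} {P : BisetSystem α} [P.RestrictionClosed] {R : Type w} [CommRing R]
  (F : BisetFunctor.{u, v} P R) {G : P.Obj}

/-- For `n ∈ A` the twisted diagonal is the stabilizer of the point `n` of the regular `A`-biset, so
inner conjugations are identities in `𝒟`. The independence of coset representatives in `cosetVal_eq`
rests on this. -/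
theorem conjHom_self {A : Sg G} {n : G} (hn : n ∈ A.subgroup)
    (h : A.subgroup = conjSub n A.subgroup) : conjHom n A A h = 𝟙 A.toObj := by
  obtain ⟨n, rfl⟩ := G.grp.exists_incl _ hn
  refine Subtype.ext (cls_coset_eq (X := regular A.toObj) n ?_ ?_)
  · intro y
    have h (y n : A.toObj) : y * n⁻¹ * n * 1⁻¹ = y := by simp
    exact ⟨((show A.toObj from y) * (show A.toObj from n)⁻¹, 1), h y n⟩
  · ext ⟨a, b⟩
    have key (a b n : A.toObj) : a * n * b⁻¹ = n ↔ a = n * b * n⁻¹ := by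
      rw [mul_inv_eq_iff_eq_mul, eq_mul_inv_iff_mul_eq]
    refine (key a b n).trans ?_
    refine (G.grp.incl_injective A.subgroup).eq_iff.symm.trans ?_
    refine Iff.trans ?_ (mem_twDiag (g := G.grp.incl A.subgroup n)).symm
    refine Eq.congr_right ?_
    refine (map_mul (G.grp.incl A.subgroup) _ _).trans ?_
    exact congrArg₂ (· * ·) (map_mul (G.grp.incl A.subgroup) _ _)
      (map_inv (G.grp.incl A.subgroup) _)

theorem map_conjHom_self {A : Sg G} {n : G} (hn : n ∈ A.subgroup)
    (h : A.subgroup = conjSub n A.subgroup) (m : F.obj.obj A.toObj) :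
    F.obj.map (conjHom n A A h) m = m := by
  rw [conjHom_self hn h, F.obj.map_id]
  rfl

theorem map_conjHom_one {A B : Sg G} (h : A = B) (h' : B.subgroup = conjSub 1 A.subgroup)
    (m : F.obj.obj A.toObj) : F.obj.map (conjHom 1 B A h') m = transp F h m := by
  subst h
  rw [transp_rfl, map_conjHom_self F A.subgroup.one_mem]

theorem map_conjHom_comp {A B C : Sg G} {g g' : G} (h : A.subgroup = conjSub g B.subgroup)
    (h' : B.subgroup = conjSub g' C.subgroup) (h'' : A.subgroup = conjSub (g * g') C.subgroup)
    (m : F.obj.obj C.toObj) :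
    F.obj.map (conjHom g A B h) (F.obj.map (conjHom g' B C h') m) =
      F.obj.map (conjHom (g * g') A C h'') m := by
  refine map_restrHom_comp F _ ?_ ?_ m
  · intro b hb
    rw [h', mem_conjSub] at hb
    exact ⟨_, hb, mem_twDiag.2 (by group)⟩
  · intro a _ c hc
    rw [mem_twDiag]
    constructor
    · rintro rfl
      refine ⟨g' * c * g'⁻¹, ?_, mem_twDiag.2 (by group), mem_twDiag.2 rfl⟩
      rw [h', mem_conjSub]
      simpa [mul_assoc] using hc
    · rintro ⟨b, -, hab, hbc⟩
      rw [mem_twDiag.1 hab, mem_twDiag.1 hbc]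
      group

theorem transp_map_conjHom {A A' B : Sg G} {g : G} (hA : A = A')
    (h : A.subgroup = conjSub g B.subgroup) (h' : A'.subgroup = conjSub g B.subgroup)
    (m : F.obj.obj B.toObj) :
    transp F hA (F.obj.map (conjHom g A B h) m) = F.obj.map (conjHom g A' B h') m := by
  subst hA
  rw [transp_rfl]

end Conjugation

/-! ## Sections over `G / A` -/

section CosetSections

variable {α : Type u} {P : BisetSystem α} [P.RestrictionClosed] {R : Type w} [CommRing R]
  {F : BisetFunctor.{u, v} P R} {G : P.Obj}

theorem cosetAdm_stab_mk (A : Sg G) {g : G} {q : (cosetAdm A).X} (h : GSet.cosetMk A.subgroup g = q) :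
    ((cosetAdm A).stab q).subgroup = conjSub g A.subgroup := by
  subst h
  exact stabilizer_coset A.subgroup g

/-- The value at `q = gA` of the section of `F` over `G / A` determined by `a ∈ F(A)`. -/
def cosetVal (A : Sg G) (a : F.obj.obj A.toObj) (g : G) (q : (cosetAdm A).X)
    (h : GSet.cosetMk A.subgroup g = q) : F.obj.obj ((cosetAdm A).stab q).toObj :=
  F.obj.map (conjHom g _ A (cosetAdm_stab_mk A h)) a

theorem conjSub_self {G : Type*} [Group G] {A : Subgroup G} {n : G} (hn : n ∈ A) :
    conjSub n A = A := by
  ext x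
  rw [mem_conjSub, mul_assoc, A.mul_mem_cancel_left (inv_mem hn), A.mul_mem_cancel_right hn]

/-- Another representative is `gn` with `n ∈ A`; conjugation by `gn` is conjugation by `n`, which is
trivial on `F(A)`, followed by conjugation by `g`. -/
theorem cosetVal_eq (A : Sg G) (a : F.obj.obj A.toObj) {g g' : G} {q : (cosetAdm A).X}
    (h : GSet.cosetMk A.subgroup g = q) (h' : GSet.cosetMk A.subgroup g' = q) :
    cosetVal A a g q h = cosetVal A a g' q h' := by
  have hn : g⁻¹ * g' ∈ A.subgroup := QuotientGroup.eq.1 (h.trans h'.symm)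
  obtain ⟨n, rfl⟩ : ∃ n, g' = g * n := ⟨g⁻¹ * g', by group⟩
  rw [inv_mul_cancel_left] at hn
  unfold cosetVal
  rw [← map_conjHom_comp F (cosetAdm_stab_mk A h) (conjSub_self hn).symm, map_conjHom_self F hn]

/-- The `G`-equivariant section of `F` over `G / A` determined by `a ∈ F(A)`. -/
def cosetSec (A : Sg G) (a : F.obj.obj A.toObj) : EqSec F (cosetAdm A) where
  val q := cosetVal A a q.out q (Quotient.out_eq q)
  property := by
    intro g
    funext q
    obtain ⟨x, hx⟩ : ∃ x, GSet.cosetMk A.subgroup x = q := ⟨_, Quotient.out_eq q⟩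
    have hx' : GSet.cosetMk A.subgroup (g⁻¹ * x) = g⁻¹ • q := by rw [← hx]; rfl
    have hx'' : GSet.cosetMk A.subgroup (g * (g⁻¹ * x)) = q := by rw [mul_inv_cancel_left, hx]
    refine (congrArg (F.obj.map _) (cosetVal_eq A a _ hx')).trans
      (Eq.trans ?_ (cosetVal_eq A a hx'' _))
    exact map_conjHom_comp F _ _ _ _

theorem cosetSec_apply (A : Sg G) (a : F.obj.obj A.toObj) {g : G} {q : (cosetAdm A).X}
    (h : GSet.cosetMk A.subgroup g = q) : (cosetSec A a).1 q = cosetVal A a g q h :=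
  cosetVal_eq A a (Quotient.out_eq q) h

theorem cosetSec_one (A : Sg G) (a : F.obj.obj A.toObj) :
    (cosetSec A a).1 ((1 : G) : G ⧸ A.subgroup) = transp F (cosetAdm_stab A).symm a :=
  (cosetSec_apply A a (g := 1) rfl).trans (map_conjHom_one F _ _ a)

/-- `G/A` is transitive, so an equivariant section is determined by its value at the trivial coset.
-/
theorem cosetSec_unique (A : Sg G) (a : F.obj.obj A.toObj) (t : EqSec F (cosetAdm A))
    (ht : t.1 ((1 : G) : G ⧸ A.subgroup) = transp F (cosetAdm_stab A).symm a) :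
    t = cosetSec A a := by
  refine Subtype.ext (funext fun q => ?_)
  obtain ⟨x, hx⟩ : ∃ x, GSet.cosetMk A.subgroup x = q := ⟨_, Quotient.out_eq q⟩
  have hq : x • GSet.cosetMk A.subgroup 1 = q := by
    rw [← hx]
    exact congrArg (GSet.cosetMk A.subgroup) (mul_one x)
  rw [← EqSec.map_conjHom t x hq ((cosetAdm A).stab_smul hq),
    ← EqSec.map_conjHom (cosetSec A a) x hq ((cosetAdm A).stab_smul hq)]
  exact congrArg (F.obj.map _) (ht.trans (cosetSec_one A a).symm)

theorem eq_cosetSec (A : Sg G) (t : EqSec F (cosetAdm A)) :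
    ∃ a, t = cosetSec A a :=
  ⟨transp F (cosetAdm_stab A) (t.1 ((1 : G) : G ⧸ A.subgroup)), cosetSec_unique A _ t (by
    rw [transp_transp, transp_rfl])⟩

variable (F) in
/-- The map `F(A) → F₊(G)`, `a ↦ [A, a]_G`. -/
def cosetCls (A : Sg G) : F.obj.obj A.toObj →ₗ[R] FPlus F G where
  toFun a := FPlus.mk ⟨cosetAdm A, cosetSec A a⟩
  map_add' a b := by
    rw [← FPlus.mk_add]
    exact congrArg (fun s => FPlus.mk ⟨_, s⟩)
      (Subtype.ext (funext fun _ => map_add (F.obj.map _).hom _ _))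
  map_smul' r a := by
    rw [FPlus.smul_mk]
    exact congrArg (fun s => FPlus.mk ⟨_, s⟩)
      (Subtype.ext (funext fun _ => map_smul (F.obj.map _).hom _ _))

/-- Right translation `G / A ≅ G / ᵍA`, `xA ↦ x g⁻¹ (ᵍA)`. -/
def cosetConj {G : Type u} [Group G] [Finite G] (A : Subgroup G) (g : G) :
    GSet.Iso (GSet.coset A) (GSet.coset (conjSub g A)) where
  toEquiv :=
    { toFun := Quotient.map' (· * g⁻¹) (by
        intro x y h
        rw [QuotientGroup.leftRel_apply] at h ⊢
        rw [mem_conjSub]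
        simpa [mul_assoc] using h)
      invFun := Quotient.map' (· * g) (by
        intro x y h
        rw [QuotientGroup.leftRel_apply] at h ⊢
        rw [mem_conjSub] at h
        simpa [mul_assoc] using h)
      left_inv := by
        rintro ⟨x⟩
        exact congrArg (QuotientGroup.mk (s := A)) (by simp)
      right_inv := by
        rintro ⟨x⟩
        exact congrArg (QuotientGroup.mk (s := conjSub g A)) (by simp) }
  map_smul := by
    rintro a ⟨x⟩
    exact congrArg (QuotientGroup.mk (s := conjSub g A)) (mul_assoc a x g⁻¹)

/-- Right translation by `g⁻¹` carries the section of `a` to that of `ᵍa`: at the image of `xA` the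
latter takes the value obtained by conjugating `a` first by `g` and then by `x g⁻¹`. -/
theorem cosetCls_conj (A : Sg G) (g : G) (a : F.obj.obj A.toObj) :
    cosetCls F (A.conj g) (F.obj.map (conjHom g (A.conj g) A rfl) a) = cosetCls F A a := by
  symm
  refine FPlus.mk_eq_of_iso (cosetConj A.subgroup g) fun q h => ?_
  obtain ⟨x, rfl⟩ : ∃ x, GSet.cosetMk A.subgroup x = q := ⟨_, Quotient.out_eq q⟩
  have hx : GSet.cosetMk (A.conj g).subgroup (x * g⁻¹) =
    (cosetConj A.subgroup g).toEquiv (GSet.cosetMk A.subgroup x) := rfl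
  refine (cosetSec_apply (A.conj g) _ hx).trans ?_
  refine Eq.trans ?_ (congrArg (transp F h) (cosetSec_apply A a rfl).symm)
  have hc : ((cosetAdm (A.conj g)).stab ((cosetConj A.subgroup g).toEquiv
      (GSet.cosetMk A.subgroup x))).subgroup = conjSub (x * g⁻¹ * g) A.subgroup := by
    rw [inv_mul_cancel_right]
    exact (congrArg Sg.subgroup h).symm.trans (cosetAdm_stab_mk A rfl)
  refine (map_conjHom_comp F _ rfl hc a).trans ?_
  have hg : x * g⁻¹ * g = x := inv_mul_cancel_right x g
  -- The conjugation morphism depends on the product `x g⁻¹ g`, so it is made a variable before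
  -- being identified with `x`.
  generalize x * g⁻¹ * g = y at hc hg
  subst hg
  exact (transp_map_conjHom F h _ _ a).symm

end CosetSections

/-! ### Cofixed points of the direct sum -/

section Cofixed

variable {α : Type u} {P : BisetSystem α} {R : Type w} [CommRing R]
  (F : BisetFunctor.{u, v} P R) (G : P.Obj)

variable {F G}

open Classical in
theorem SumSg.addHom_ext {M : Type*} [AddCommGroup M] {f g : SumSg F G →+ M}
    (h : ∀ A a, f (SumSg.incl F G A a) = g (SumSg.incl F G A a)) : f = g :=
  DirectSum.addHom_ext h

theorem SumSg.linearMap_ext {M : Type*} [AddCommGroup M] [Module R M] {f g : SumSg F G →ₗ[R] M}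
    (h : ∀ A a, f (SumSg.incl F G A a) = g (SumSg.incl F G A a)) : f = g := by
  have h' : f.toAddMonoidHom = g.toAddMonoidHom := SumSg.addHom_ext h
  exact LinearMap.ext fun x => DFunLike.congr_fun h' x

variable (F G)

open Classical in
/-- Linear maps out of the direct sum of the `F(A)`. -/
def SumSg.lift {M : Type*} [AddCommGroup M] [Module R M]
    (f : ∀ A : Sg G, F.obj.obj A.toObj →ₗ[R] M) : SumSg F G →ₗ[R] M :=
  DirectSum.toModule R (Sg G) M f

open Classical in
theorem SumSg.lift_incl {M : Type*} [AddCommGroup M] [Module R M]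
    (f : ∀ A : Sg G, F.obj.obj A.toObj →ₗ[R] M) (A : Sg G) (a : F.obj.obj A.toObj) :
    SumSg.lift F G f (SumSg.incl F G A a) = f A a :=
  DirectSum.toModule_lof R (M := fun A : Sg G => F.obj.obj A.toObj) (φ := f) A a

variable [P.RestrictionClosed]

theorem SumSg.incl_transp {A B : Sg G} (h : A = B) (a : F.obj.obj A.toObj) :
    SumSg.incl F G B (transp F h a) = SumSg.incl F G A a := by
  subst h
  rw [transp_rfl]

/-- The action of `g ∈ G` on the direct sum of the `F(A)`. -/
def conjMap (g : G) : SumSg F G →ₗ[R] SumSg F G :=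
  SumSg.lift F G fun A =>
    SumSg.incl F G (A.conj g) ∘ₗ (F.obj.map (conjHom g (A.conj g) A rfl)).hom

theorem conjMap_incl (g : G) (A : Sg G) (a : F.obj.obj A.toObj) :
    conjMap F G g (SumSg.incl F G A a) =
      SumSg.incl F G (A.conj g) (F.obj.map (conjHom g (A.conj g) A rfl) a) :=
  SumSg.lift_incl F G _ A a

/-- Lets the target be any subgroup equal to `ᵍA`, such as a point stabilizer, so that no transport
appears. -/
theorem conjMap_incl_of_eq {g : G} {A B : Sg G} (h : B.subgroup = conjSub g A.subgroup)
    (a : F.obj.obj A.toObj) : conjMap F G g (SumSg.incl F G A a) =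
      SumSg.incl F G B (F.obj.map (conjHom g B A h) a) := by
  obtain rfl : B = A.conj g := Sg.ext h
  exact conjMap_incl F G g A a

/-- The direct sum of the `F(A)` as a representation of `G`. -/
def conjRep : Representation R G (SumSg F G) where
  toFun := conjMap F G
  map_one' := by
    refine SumSg.linearMap_ext fun A a => ?_
    rw [conjMap_incl_of_eq F G (conjSub_self A.subgroup.one_mem).symm,
      map_conjHom_self F A.subgroup.one_mem]
    rfl
  map_mul' g g' := by
    refine SumSg.linearMap_ext fun A a => ?_
    have h : ((A.conj g').conj g).subgroup = conjSub (g * g') A.subgroup := by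
      ext x
      change x ∈ conjSub g (conjSub g' A.subgroup) ↔ _
      rw [mem_conjSub, mem_conjSub, mem_conjSub]
      simp [mul_assoc]
    rw [conjMap_incl_of_eq F G h, ← map_conjHom_comp F rfl rfl h, Module.End.mul_apply,
      conjMap_incl, conjMap_incl]

theorem coinvariants_mk_incl {A B : Sg G} {g : G} (h : B.subgroup = conjSub g A.subgroup)
    (a : F.obj.obj A.toObj) :
    Representation.Coinvariants.mk (conjRep F G)
        (SumSg.incl F G B (F.obj.map (conjHom g B A h) a)) =
      Representation.Coinvariants.mk (conjRep F G) (SumSg.incl F G A a) := by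
  rw [← conjMap_incl_of_eq F G h]
  exact Representation.Coinvariants.mk_self_apply (conjRep F G) g _

/-- The map from the cofixed points to `F₊(G)`, induced by `a ↦ [A, a]_G`. -/
def cofixedMap : (conjRep F G).Coinvariants →ₗ[R] FPlus F G :=
  Representation.Coinvariants.lift (conjRep F G) (SumSg.lift F G (cosetCls F)) (fun g => by
    refine SumSg.linearMap_ext fun A a => ?_
    refine (congrArg (SumSg.lift F G (cosetCls F)) (conjMap_incl F G g A a)).trans ?_
    rw [SumSg.lift_incl, SumSg.lift_incl, cosetCls_conj])

theorem cofixedMap_mk (A : Sg G) (a : F.obj.obj A.toObj) :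
    cofixedMap F G (Representation.Coinvariants.mk (conjRep F G) (SumSg.incl F G A a)) =
      cosetCls F A a :=
  (Representation.Coinvariants.lift_mk _ _ _ _).trans (SumSg.lift_incl F G _ A a)

/-- The class of `s(x) ∈ F(G_x)` in the cofixed points. -/
def secCls {X : AdmSet G} (s : EqSec F X) (x : X.X) : (conjRep F G).Coinvariants :=
  Representation.Coinvariants.mk (conjRep F G) (SumSg.incl F G (X.stab x) (s.1 x))

/-- Since `s(gx) = ᵍ(s(x))`, the class is constant on orbits, which makes the sum over orbits
meaningful. -/
theorem secCls_smul {X : AdmSet G} (s : EqSec F X) (g : G) (x : X.X) :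
    secCls F G s (g • x) = secCls F G s x := by
  unfold secCls
  rw [← EqSec.map_conjHom s g rfl (X.stab_smul rfl), coinvariants_mk_incl]

theorem secCls_of_transp {X Y : AdmSet G} {s : EqSec F X} {t : EqSec F Y} {x : X.X} {y : Y.X}
    (h : X.stab x = Y.stab y) (hs : t.1 y = transp F h (s.1 x)) :
    secCls F G t y = secCls F G s x := by
  unfold secCls
  rw [hs, SumSg.incl_transp]

/-- The map from `F₊(G)` to the cofixed points sending `[X, s]` to the sum of the classes of
`s(x)` over representatives `x` of the orbits of `X`. -/
def toCofixed : FPlus F G →+ (conjRep F G).Coinvariants :=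
  FPlus.lift (fun a => orbitSum a.X.X (secCls F G a.s) (secCls_smul F G a.s))
    (fun a b e => by
      refine orbitSum_iso ⟨⟨e.hom.toFun, e.inv.toFun, ?_, ?_⟩, e.hom.map_smul⟩ _ _ fun x => ?_
      · exact fun x => congrFun (congrArg Gam.Hom.toFun e.hom_inv_id) x
      · exact fun x => congrFun (congrArg Gam.Hom.toFun e.inv_hom_id) x
      · exact (secCls_of_transp F G (e.hom.stab_eq x) (e.hom.section_eq x)).symm)
    (fun a b => orbitSum_sum a.X.X b.X.X _ _ _
      (fun x => secCls_of_transp F G (a.X.stab_inl b.X x) rfl)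
      (fun y => secCls_of_transp F G (a.X.stab_inr b.X y) rfl))
    (fun X s t => by
      have h : secCls F G (s + t) = secCls F G s + secCls F G t := by
        funext x
        exact (congrArg _ (map_add (SumSg.incl F G (X.stab x)) (s.1 x) (t.1 x))).trans
          (map_add _ _ _)
      refine Eq.trans ?_ (orbitSum_add X.X (secCls_smul F G s) (secCls_smul F G t)
        (fun g x => by rw [← h, secCls_smul]))
      congr 1)

theorem toCofixed_cosetCls (A : Sg G) (a : F.obj.obj A.toObj) :
    toCofixed F G (cosetCls F A a) =
      Representation.Coinvariants.mk (conjRep F G) (SumSg.incl F G A a) := by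
  refine (FPlus.lift_mk _ _ _ _ _).trans ?_
  refine (orbitSum_of_transitive _ _ (GSet.cosetMk A.subgroup 1) ?_).trans ?_
  · intro y
    obtain ⟨g, rfl⟩ : ∃ g, GSet.cosetMk A.subgroup g = y := ⟨_, Quotient.out_eq y⟩
    exact ⟨g, congrArg (GSet.cosetMk A.subgroup) (mul_one g)⟩
  · refine congrArg (Representation.Coinvariants.mk (conjRep F G)) ?_
    refine (congrArg (SumSg.incl F G _) (cosetSec_one A a)).trans ?_
    exact SumSg.incl_transp F G (cosetAdm_stab A).symm a

/-- `toCofixed` is a left inverse: `G/A` is one orbit, and evaluating the section at its trivial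
coset returns the class of `a`. -/
theorem cofixedMap_injective : Function.Injective (cofixedMap F G) := by
  let mk := (Representation.Coinvariants.mk (conjRep F G)).toAddMonoidHom
  have h : ((toCofixed F G).comp (cofixedMap F G).toAddMonoidHom).comp mk = mk :=
    SumSg.addHom_ext fun A a => (congrArg (toCofixed F G) (cofixedMap_mk F G A a)).trans
      (toCofixed_cosetCls F G A a)
  refine Function.LeftInverse.injective (g := toCofixed F G) fun x => ?_
  obtain ⟨x, rfl⟩ := Representation.Coinvariants.mk_surjective _ x
  exact DFunLike.congr_fun h x

/-! ### Orbit decomposition and surjectivity -/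

variable {F G}

/-- The pullback of a section along an injective map of `G`-sets. -/
def Gam.pullback (a : Gam F G) {Y : GSet G} {f : Y → a.X.X} (hf : Function.Injective f)
    (hs : ∀ (g : G) y, f (g • y) = g • f y) : Gam F G :=
  have hst (y : Y) : MulAction.stabilizer G (f y) = MulAction.stabilizer G y := by
    ext g
    rw [MulAction.mem_stabilizer_iff, MulAction.mem_stabilizer_iff, ← hs, hf.eq_iff]
  let Y' : AdmSet G := ⟨Y, fun y => hst y ▸ a.X.mem (f y)⟩
  have hst' (y : Y) : a.X.stab (f y) = Y'.stab y := Sg.ext (hst y)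
  { X := Y'
    s := ⟨fun y => transp F (hst' y) (a.s.1 (f y)), by
      intro g
      funext y
      have h : (a.X.stab (f y)).subgroup = conjSub g (a.X.stab (f (g⁻¹ • y))).subgroup := by
        refine a.X.stab_smul ?_
        rw [← hs, smul_inv_smul]
      refine (conjHom_transp F (hst' y) (hst' (g⁻¹ • y)) h (Y'.stab_conj g y) _).trans ?_
      refine congrArg (transp F (hst' y)) (EqSec.map_conjHom a.s g ?_ h)
      rw [← hs, smul_inv_smul]⟩ }

/-- Turns the defining relation for external coproducts into one for a decomposition of `X` into two
stable pieces. -/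
theorem FPlus.mk_eq_add (a : Gam F G) {Y Z : GSet G} {f : Y → a.X.X} {f' : Z → a.X.X}
    (hf : Function.Injective f) (hf' : Function.Injective f')
    (hs : ∀ (g : G) y, f (g • y) = g • f y) (hs' : ∀ (g : G) y, f' (g • y) = g • f' y)
    (h : Function.Bijective (Sum.elim f f')) :
    mk a = mk (a.pullback hf hs) + mk (a.pullback hf' hs') := by
  rw [← mk_coprod]
  symm
  refine mk_eq_of_iso (GSet.isoOfBijective (X := Y.sum Z) (Sum.elim f f') h ?_) ?_
  · rintro g (y | z)
    · exact hs g y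
    · exact hs' g z
  · rintro (y | z) hst
    · refine Eq.trans ?_ (transp_transp F _ hst _).symm
      exact ((transp_transp F _ _ _).trans (transp_rfl F rfl _)).symm
    · refine Eq.trans ?_ (transp_transp F _ hst _).symm
      exact ((transp_transp F _ _ _).trans (transp_rfl F rfl _)).symm

/-- An empty set is the disjoint union of two copies of itself, so its class equals its own double.
-/
theorem FPlus.mk_eq_zero_of_isEmpty (a : Gam F G) [IsEmpty a.X.X] : mk a = 0 := by
  have h := mk_eq_add a (Y := a.X.X) (Z := a.X.X) (f := id) (f' := id) Function.injective_id
    Function.injective_id (fun _ _ => rfl) (fun _ _ => rfl)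
    ⟨fun x => isEmptyElim (Sum.elim id id x : a.X.X), fun x => isEmptyElim x⟩
  have h' : mk (a.pullback (Y := a.X.X) (f := id) Function.injective_id fun _ _ => rfl) = mk a :=
    congrArg (fun s => mk ⟨a.X, s⟩) (Subtype.ext (funext fun x => isEmptyElim x))
  rw [h'] at h
  exact left_eq_add.1 h

/-- Induction on the size of `X`: one orbit `G/G_x` is split off, where the section comes from an
element of `F(G_x)`, and the complement is smaller. -/
theorem mk_mem_range (a : Gam F G) : FPlus.mk a ∈ LinearMap.range (cofixedMap F G) := by
  induction hn : Nat.card a.X.X using Nat.strong_induction_on generalizing a with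
  | _ n ih =>
  subst hn
  rcases isEmpty_or_nonempty a.X.X with he | ⟨⟨x⟩⟩
  · rw [FPlus.mk_eq_zero_of_isEmpty]
    exact zero_mem _
  · have hO (g : G) : ∀ y ∈ (MulAction.orbit G x)ᶜ, g • y ∈ (MulAction.orbit G x)ᶜ :=
      fun y hy h => hy (by simpa using MulAction.mem_orbit_of_mem_orbit g⁻¹ h)
    rw [FPlus.mk_eq_add a (Y := GSet.coset (MulAction.stabilizer G x))
      (Z := a.X.X.ofSet (MulAction.orbit G x)ᶜ hO)
      (MulAction.injective_ofQuotientStabilizer G x) Subtype.val_injective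
      (MulAction.ofQuotientStabilizer_smul G x) (fun _ _ => rfl) ?_]
    · refine add_mem ?_ (ih _ ?_ _ rfl)
      -- The pulled back set is definitionally `cosetAdm (a.X.stab x)`, since the two differ only in
      -- proofs.
      · obtain ⟨m, hm⟩ := eq_cosetSec (a.X.stab x) (a.pullback
          (Y := GSet.coset (MulAction.stabilizer G x))
          (MulAction.injective_ofQuotientStabilizer G x)
          (MulAction.ofQuotientStabilizer_smul G x)).s
        exact ⟨_, (cofixedMap_mk F G (a.X.stab x) m).trans
          (congrArg (fun s => FPlus.mk ⟨_, s⟩) hm.symm)⟩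
      · refine lt_of_lt_of_eq (Set.ncard_lt_ncard (s := (MulAction.orbit G x)ᶜ)
          (t := Set.univ) ?_) (Set.ncard_univ _)
        refine Set.ssubset_univ_iff.2 fun h => ?_
        have : x ∈ (MulAction.orbit G x)ᶜ := h ▸ Set.mem_univ x
        exact this (MulAction.mem_orbit_self x)
    · constructor
      · refine Function.Injective.sumElim (MulAction.injective_ofQuotientStabilizer G x)
          Subtype.val_injective fun q y h => ?_
        exact y.2 (h ▸ MulAction.ofQuotientStabilizer_mem_orbit G x q)
      · intro y
        by_cases hy : y ∈ MulAction.orbit G x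
        · obtain ⟨g, rfl⟩ := hy
          exact ⟨Sum.inl (GSet.cosetMk _ g), rfl⟩
        · exact ⟨Sum.inr ⟨y, hy⟩, rfl⟩

variable (F G)

theorem cofixedMap_surjective : Function.Surjective (cofixedMap F G) := by
  rw [← LinearMap.range_eq_top, ← Submodule.ker_mkQ (LinearMap.range (cofixedMap F G)),
    LinearMap.ker_eq_top]
  refine FPlus.linearMap_ext fun a => ?_
  exact (Submodule.Quotient.mk_eq_zero _).2 (mk_mem_range a)

/-- The isomorphism between the cofixed points and `F₊(G)`. -/
def cofixedEquiv : (conjRep F G).Coinvariants ≃ₗ[R] FPlus F G :=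
  LinearEquiv.ofBijective (cofixedMap F G) ⟨cofixedMap_injective F G, cofixedMap_surjective F G⟩

instance : Finite (Sg G) := Finite.of_injective Sg.subgroup fun _ _ h => Sg.ext h

/-- The construction ranges over all finite `G`-sets and so lands in a larger universe. Being a
quotient of a direct sum of modules `F(A)` over the finite set `Σ_𝒢(G)`, `F₊(G)` still has a model
in the universe of the `F(A)`. -/
instance : Small.{v} (FPlus F G) := by
  have h : Small.{v} (SumSg F G) := small_of_injective (β := ∀ A : Sg G, F.obj.obj A.toObj)
    (f := fun x A => x A) DFunLike.coe_injective
  exact small_of_surjective ((cofixedMap_surjective F G).comp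
    (Representation.Coinvariants.mk_surjective _))

end Cofixed

/-! ### Linear maps between small models -/

section ShrinkHom

variable {R : Type w} [Ring R] {L M N : Type*} [AddCommGroup L] [AddCommGroup M] [AddCommGroup N]
  [Module R L] [Module R M] [Module R N] [Small.{v} L] [Small.{v} M] [Small.{v} N]

/-- The linear map between small models induced by a linear map. -/
def shrinkHom (f : M →ₗ[R] N) :
    ModuleCat.of R (Shrink.{v} M) ⟶ ModuleCat.of R (Shrink.{v} N) :=
  ModuleCat.ofHom ((Shrink.linearEquiv.{v} R N).symm.toLinearMap ∘ₗ f ∘ₗ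
    (Shrink.linearEquiv.{v} R M).toLinearMap)

theorem shrinkHom_apply (f : M →ₗ[R] N) (m : M) :
    shrinkHom.{v} f ((Shrink.linearEquiv.{v} R M).symm m) =
      (Shrink.linearEquiv.{v} R N).symm (f m) := by
  refine congrArg (fun m => (Shrink.linearEquiv.{v} R N).symm (f m)) ?_
  exact LinearEquiv.apply_symm_apply _ _

theorem shrinkHom_ext {f g : ModuleCat.of R (Shrink.{v} M) ⟶ ModuleCat.of R (Shrink.{v} N)}
    (h : ∀ m : M, f ((Shrink.linearEquiv.{v} R M).symm m) =
      g ((Shrink.linearEquiv.{v} R M).symm m)) : f = g := by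
  refine ModuleCat.hom_ext (LinearMap.ext fun x => ?_)
  obtain ⟨m, rfl⟩ := (Shrink.linearEquiv.{v} R M).symm.surjective x
  exact h m

theorem shrinkHom_id : shrinkHom.{v} (LinearMap.id : M →ₗ[R] M) = 𝟙 _ :=
  shrinkHom_ext fun m => shrinkHom_apply _ m

theorem shrinkHom_comp (f : L →ₗ[R] M) (g : M →ₗ[R] N) :
    shrinkHom.{v} (g ∘ₗ f) = shrinkHom.{v} f ≫ shrinkHom.{v} g :=
  shrinkHom_ext fun m => by
    rw [shrinkHom_apply, ModuleCat.comp_apply, shrinkHom_apply, shrinkHom_apply,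
      LinearMap.comp_apply]

theorem shrinkHom_add (f g : M →ₗ[R] N) :
    shrinkHom.{v} (f + g) = shrinkHom.{v} f + shrinkHom.{v} g :=
  shrinkHom_ext fun m => by
    rw [shrinkHom_apply, LinearMap.add_apply, map_add, ← shrinkHom_apply, ← shrinkHom_apply]
    rfl

end ShrinkHom

theorem shrinkHom_smul {R : Type w} [CommRing R] {M N : Type*} [AddCommGroup M] [AddCommGroup N]
    [Module R M] [Module R N] [Small.{v} M] [Small.{v} N] (r : R) (f : M →ₗ[R] N) :
    shrinkHom.{v} (r • f) = r • shrinkHom.{v} f :=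
  shrinkHom_ext fun m => by
    rw [shrinkHom_apply, LinearMap.smul_apply, map_smul, ← shrinkHom_apply]
    rfl

/-! ### The biset functor `F₊` and its functoriality in `F` -/

section PlusFunctor

variable {α : Type u} {P : BisetSystem α} [P.RestrictionClosed] {R : Type w} [CommRing R]

/-- An object of `𝒟₊`, as an object of `𝒟`. -/
def BisetSystem.Obj.ofPlus (G : P.plus.Obj) : P.Obj := ⟨G.grp, G.mem⟩

/-- The underlying functor of the biset functor `F₊`. -/
def plusFunctor (F : BisetFunctor.{u, v} P R) : P.plus.Obj ⥤ ModuleCat.{v} R where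
  obj G := ModuleCat.of R (Shrink.{v} (FPlus F G.ofPlus))
  map {H G} f := shrinkHom (burnsideAct G.ofPlus H.ofPlus F f.1)
  map_id G := (congrArg _ (burnsideAct_regular F G.ofPlus)).trans shrinkHom_id
  map_comp {K H G} f g := by
    -- The membership proofs `g.2` and `f.2` supply the hypotheses under which the action is
    -- multiplicative.
    have h := burnsideAct_comp (G := G.ofPlus) (H := H.ofPlus) (K := K.ofPlus) F g.2 f.2
    exact (congrArg shrinkHom h).trans (shrinkHom_comp _ _)

instance (F : BisetFunctor.{u, v} P R) : (plusFunctor F).Additive where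
  map_add {H G f g} := (congrArg _ (map_add (burnsideAct G.ofPlus H.ofPlus F) f.1 g.1)).trans
    (shrinkHom_add _ _)

variable {F F' F'' : BisetFunctor.{u, v} P R} {G H : P.Obj}

/-- The section `φ(s)`. -/
def mapSec (φ : F ⟶ F') {X : AdmSet G} (s : EqSec F X) : EqSec F' X where
  val x := φ.hom.app (X.stab x).toObj (s.1 x)
  property g := by
    funext x
    refine (NatTrans.naturality_apply φ.hom (conjHom g (X.stab x) (X.stab (g⁻¹ • x)) _) _).symm.trans
      ?_
    exact congrArg (φ.hom.app _) (congrFun (s.2 g) x)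

/-- The map `F₊(G) → F'₊(G)`, `[X, s] ↦ [X, φ(s)]`. -/
def plusMap (φ : F ⟶ F') (G : P.Obj) : FPlus F G →ₗ[R] FPlus F' G :=
  FPlus.liftLinear (fun a => FPlus.mk ⟨a.X, mapSec φ a.s⟩)
    (fun a b e => by
      refine FPlus.mk_eq_of_iso ⟨⟨e.hom.toFun, e.inv.toFun, ?_, ?_⟩, e.hom.map_smul⟩ fun x h => ?_
      · exact fun x => congrFun (congrArg Gam.Hom.toFun e.hom_inv_id) x
      · exact fun x => congrFun (congrArg Gam.Hom.toFun e.inv_hom_id) x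
      · exact (congrArg (φ.hom.app _) (e.hom.section_eq x)).trans (transp_map_app φ h _))
    (fun a b => by
      rw [← FPlus.mk_coprod]
      refine congrArg (fun s => FPlus.mk ⟨a.X.sum b.X, s⟩) (Subtype.ext (funext fun x => ?_))
      rcases x with x | x
      · exact transp_map_app φ _ _
      · exact transp_map_app φ _ _)
    (fun X s t => by
      rw [← FPlus.mk_add]
      exact congrArg (fun s => FPlus.mk ⟨X, s⟩)
        (Subtype.ext (funext fun x => map_add (φ.hom.app (X.stab x).toObj).hom _ _)))
    (fun r a => by
      rw [FPlus.smul_mk]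
      exact congrArg (fun s => FPlus.mk ⟨a.X, s⟩)
        (Subtype.ext (funext fun x => map_smul (φ.hom.app (a.X.stab x).toObj).hom _ _)))

theorem plusMap_mk (φ : F ⟶ F') (a : Gam F G) :
    plusMap φ G (FPlus.mk a) = FPlus.mk ⟨a.X, mapSec φ a.s⟩ :=
  FPlus.liftLinear_mk _ _ _ _ _ a

/-- The value of `U(s)` at a point is `F` of a morphism of `𝒟` applied to a value of `s`, so
naturality of `φ` gives `φ(U(s)) = U(φ(s))` pointwise. -/
theorem plusMap_actMap (φ : F ⟶ F') (U : GSet (G × H))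
    (hU : ∀ u : U, MulAction.stabilizer (G × H) u ∈ P.SPlus G.grp H.grp) :
    plusMap φ G ∘ₗ actMap U hU = actMap U hU ∘ₗ plusMap φ H := by
  refine FPlus.linearMap_ext fun a => ?_
  rw [LinearMap.comp_apply, LinearMap.comp_apply, actMap_mk, plusMap_mk, plusMap_mk, actMap_mk]
  refine congrArg (fun s => FPlus.mk ⟨actAdm U hU a.X, s⟩) (Subtype.ext (funext fun q => ?_))
  exact NatTrans.naturality_apply φ.hom (restrHom _ ((actAdm U hU a.X).stab q) _ _) _

/-- Valid on the whole of `B(G, H)`, because the points that are discarded do not depend on the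
functor. -/
theorem plusMap_burnsideAct (φ : F ⟶ F') (x : Burnside (G × H)) :
    plusMap φ G ∘ₗ burnsideAct G H F x = burnsideAct G H F' x ∘ₗ plusMap φ H := by
  induction x using Burnside.ind with
  | hs x y hx hy => simp only [map_sub, LinearMap.comp_sub, LinearMap.sub_comp, hx, hy]
  | hc U =>
  exact (congrArg _ (lift_cls (bmonAct G H F) U)).trans
    ((plusMap_actMap φ (plusPart U) (plusPart_mem U)).trans
      (congrArg (· ∘ₗ plusMap φ H) (lift_cls (bmonAct G H F') U).symm))

theorem plusMap_id (F : BisetFunctor.{u, v} P R) (G : P.Obj) :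
    plusMap (𝟙 F) G = LinearMap.id :=
  FPlus.linearMap_ext fun a => plusMap_mk _ a

theorem plusMap_comp (φ : F ⟶ F') (ψ : F' ⟶ F'') (G : P.Obj) :
    plusMap (φ ≫ ψ) G = plusMap ψ G ∘ₗ plusMap φ G :=
  FPlus.linearMap_ext fun a => by
    rw [LinearMap.comp_apply, plusMap_mk, plusMap_mk, plusMap_mk]
    rfl

theorem plusMap_add (φ ψ : F ⟶ F') (G : P.Obj) :
    plusMap (φ + ψ) G = plusMap φ G + plusMap ψ G :=
  FPlus.linearMap_ext fun a => by
    rw [LinearMap.add_apply, plusMap_mk, plusMap_mk, plusMap_mk, ← FPlus.mk_add]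
    rfl

theorem plusMap_smul (r : R) (φ : F ⟶ F') (G : P.Obj) :
    plusMap (r • φ) G = r • plusMap φ G :=
  FPlus.linearMap_ext fun a => by
    rw [LinearMap.smul_apply, plusMap_mk, plusMap_mk, FPlus.smul_mk]
    rfl

/-- The natural transformation `F₊ ⟶ F'₊` induced by `φ : F ⟶ F'`. -/
def plusNatTrans (φ : F ⟶ F') : plusFunctor F ⟶ plusFunctor F' where
  app G := shrinkHom (plusMap φ G.ofPlus)
  naturality H G f := by
    have h := plusMap_burnsideAct (G := G.ofPlus) (H := H.ofPlus) φ f.1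
    exact (shrinkHom_comp _ _).symm.trans ((congrArg shrinkHom h).trans (shrinkHom_comp _ _))

variable (P R) in
/-- The functor `F ↦ F₊`. -/
def plusFunctorial : BisetFunctor.{u, v} P R ⥤ BisetFunctor.{u, v} P.plus R where
  obj F := ⟨plusFunctor F, inferInstanceAs (plusFunctor F).Additive⟩
  map φ := ObjectProperty.homMk (plusNatTrans φ)
  map_id F := by
    refine ObjectProperty.hom_ext _ (NatTrans.ext (funext fun G => ?_))
    exact (congrArg _ (plusMap_id F G.ofPlus)).trans shrinkHom_id
  map_comp φ ψ := by
    refine ObjectProperty.hom_ext _ (NatTrans.ext (funext fun G => ?_))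
    exact (congrArg _ (plusMap_comp φ ψ G.ofPlus)).trans (shrinkHom_comp _ _)

instance : (plusFunctorial.{u, v} P R).Additive where
  map_add {F F' φ ψ} := by
    refine ObjectProperty.hom_ext _ (NatTrans.ext (funext fun G => ?_))
    exact (congrArg _ (plusMap_add φ ψ G.ofPlus)).trans (shrinkHom_add _ _)

instance : (plusFunctorial.{u, v} P R).Linear R where
  map_smul φ r := by
    refine ObjectProperty.hom_ext _ (NatTrans.ext (funext fun G => ?_))
    exact (congrArg _ (plusMap_smul r φ G.ofPlus)).trans (shrinkHom_smul _ _)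

end PlusFunctor

end BisetPlus

end

/-! ### Assembly of the theorem -/

open BisetPlus BisetPlus.BisetSystem in
theorem mainTheorem1 {α : Type u} (P : BisetSystem α) [P.RestrictionClosed]
    (R : Type w) [CommRing R] :
    ∃ (Φ : BisetFunctor.{u, v} P R ⥤ BisetFunctor.{u, v} P.plus R)
      (e : ∀ (F : BisetFunctor.{u, v} P R) (G : P.Obj),
        FPlus F G ≃ₗ[R] (Φ.obj F).obj.obj G.toPlus),
      -- `Φ` is an `R`-linear functor
      (∃ _ : Φ.Additive, Φ.Linear R) ∧
      -- for a `(G, H)`-biset `U`, the functor `F₊ = Φ F` maps `[U]` to the map induced by the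
      -- functor `Γ_F(U) : (X, s) ↦ (U ×_H X, U(s))`
      (∀ (F : BisetFunctor.{u, v} P R) (G H : P.Obj) (U : GSet (G × H))
        (hU : ∀ x : U, MulAction.stabilizer (G × H) x ∈ P.SPlus G.grp H.grp),
        ∃ t : ∀ a : Gam F H, EqSec F (actAdm U hU a.X),
          (∀ (a : Gam F H) (x : U) (y : a.X.X),
            (t a).1 (actSet.mk x y) = F.obj.map (actHom U hU a.X x y) (a.s.1 y)) ∧
          (∀ (a b : Gam F H) (f : a ⟶ b),
            ∃ f' : (⟨actAdm U hU a.X, t a⟩ : Gam F G) ⟶ ⟨actAdm U hU b.X, t b⟩,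
              ∀ (x : U) (y : a.X.X), f'.toFun (actSet.mk x y) = actSet.mk x (f.toFun y)) ∧
          ∀ a : Gam F H, (Φ.obj F).obj.map (plusHom U hU) (e F H (FPlus.mk a)) =
            e F G (FPlus.mk ⟨actAdm U hU a.X, t a⟩)) ∧
      -- on morphisms `φ : F ⟶ F'`, `Φ` is induced by `(X, s) ↦ (X, φ(s))`
      (∀ (F F' : BisetFunctor.{u, v} P R) (φ : F ⟶ F') (G : P.Obj) (X : AdmSet G) (s : EqSec F X),
        ∃ t : EqSec F' X,
          (∀ x : X.X, t.1 x = φ.hom.app (X.stab x).toObj (s.1 x)) ∧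
          (Φ.map φ).hom.app G.toPlus (e F G (FPlus.mk ⟨X, s⟩)) = e F' G (FPlus.mk ⟨X, t⟩)) ∧
      -- `F₊(G)` is isomorphic to the `G`-cofixed points of `⨁ F(A)`
      (∀ (F : BisetFunctor.{u, v} P R) (G : P.Obj),
        ∃ ρ : Representation R G (SumSg F G),
          (∀ (g : G) (A : Sg G) (a : F.obj.obj A.toObj),
            ρ g (SumSg.incl F G A a) =
              SumSg.incl F G (A.conj g) (F.obj.map (conjHom g (A.conj g) A rfl) a)) ∧
          ∃ θ : ρ.Coinvariants ≃ₗ[R] FPlus F G,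
            ∀ (A : Sg G) (a : F.obj.obj A.toObj),
              ∃ t : EqSec F (cosetAdm A),
                t.1 ((1 : G) : G ⧸ A.subgroup) = transp F (cosetAdm_stab A).symm a ∧
                (∀ t' : EqSec F (cosetAdm A),
                  t'.1 ((1 : G) : G ⧸ A.subgroup) = transp F (cosetAdm_stab A).symm a → t' = t) ∧
                θ (Representation.Coinvariants.mk ρ (SumSg.incl F G A a)) =
                  FPlus.mk ⟨cosetAdm A, t⟩) := by
  refine ⟨plusFunctorial P R, fun F G => (Shrink.linearEquiv.{v} R (FPlus F G)).symm,
    ⟨inferInstance, inferInstance⟩, fun F G H U hU => ⟨fun a => actSec U hU a.s,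
      fun a x y => actSec_apply U hU a.s rfl,
      fun a b f => ⟨actGamMap U hU f, fun _ _ => rfl⟩, fun a => ?_⟩,
    fun F F' φ G X s => ⟨mapSec φ s, fun _ => rfl, ?_⟩, fun F G => ⟨conjRep F G, conjMap_incl F G,
      cofixedEquiv F G, fun A a => ⟨cosetSec A a, cosetSec_one A a, cosetSec_unique A a,
        cofixedMap_mk F G A a⟩⟩⟩
  · refine (shrinkHom_apply _ _).trans (congrArg (Shrink.linearEquiv.{v} R (FPlus F G)).symm ?_)
    -- All stabilizers of `U` lie in `𝒮₊(G, H)`, so nothing is discarded and `[U]` acts through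
    -- `actMap`.
    exact (LinearMap.congr_fun (burnsideAct_cls F U hU) _).trans (actMap_mk U hU a)
  · refine (shrinkHom_apply _ _).trans (congrArg (Shrink.linearEquiv.{v} R (FPlus F' G)).symm ?_)
    exact plusMap_mk φ _
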